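/- **Setting.** Let $\mathbb{D}$ be a Dedekind domain and let $H$ be a Hopf algebra over $\mathbb{D}$, with antipode $S$, counit $\epsilon$ and coproduct $\Delta(x)=\sum x'\otimes x''$, which is finitely generated and projective as a $\mathbb{D}$-module. For a Hopf algebra $A$, put $A^*=\mathrm{Hom}_{\mathbb D}(A,\mathbb D)$ with product $(fh)(x)=\sum f(x')h(x'')$. A *right integral* on $A$ is a $\lambda\in A^*$ with $\lambda f=f(1)\lambda$ for all $f\in A^*$; a *left* (resp. *right*) *cointegral* in $A$ is a $\Lambda\in A$ with $x\Lambda=\epsilon(x)\Lambda$ (resp. $\Lambda x=\epsilon(x)\Lambda$) for all $x\in A$. Write $f\rightharpoonup a=\sum f(a'')a'$, $a\leftharpoonup f=\sum f(a')a''$ for $f\in A^*$, $a\in A$, and $(f\leftharpoonup a)(b)=f(ab)$, $(a\rightharpoonup f)(b)=f(ba)$. $G(A)$ denotes the group of group-like elements; $G(A^*)$ is the group of algebra maps $A\to\mathbb{D}$. Let $\Lambda\in H$ be a left cointegral and $\lambda\in H^*$ a right integral with $\lambda(\Lambda)=\lambda(S(\Lambda))=1$, and let $\alpha\in G(H^*)$,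 $g\in G(H)$ be the moduli: $\Lambda x=\alpha(x)\Lambda$ for all $x\in H$ and $f\lambda=f(g)\lambda$ for all $f\in H^*$. Suppose that $H$ is *double balanced*: there are $\beta\in G(H^*)$ and $l\in G(H)$ with $\beta^2=\alpha$, $l^2=g$ and $$S^2(x)=l\,(\beta\rightharpoonup x\leftharpoonup\beta^{-1})\,l^{-1}\qquad\text{for all }x\in H.$$ (In particular $S$ is invertible.) Note that $\beta(l)$ is a unit of $\mathbb{D}$. The quantum double $D(H)$ is $H^{*\mathrm{cop}}\otimes H$ as a coalgebra, so $\Delta(f\otimes x)=\sum(f''\otimes x')\otimes(f'\otimes x'')$ with $f(xy)=\sum f'(x)f''(y)$, with counit $f\otimes x\mapsto f(1)\epsilon(x)$, unit $\epsilon\otimes1$, product $$(p\otimes x)(q\otimes y)=\sum p\,\bigl(x'\rightharpoonup q\leftharpoonup S^{-1}(x''')\bigr)\otimes x''y,$$ and antipode $\mathbf{S}(f\otimes x)=(\epsilon\otimes S(x))\,(f\circ S^{-1}\otimes 1)$. Let $\sum_i h^i\otimes h_i\in H^*\otimes H$ be the element with $x=\sum_i h^i(x)h_i$ for all $x\in H$;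 the canonical $R$-matrix is $\sum_i(\epsilon\otimes h_i)\otimes(h^i\otimes1)$, and $$r=\Bigl(\sum_i\mathbf{S}(h^i\otimes1)(\epsilon\otimes h_i)\Bigr)(\beta^{-1}\otimes l^{-1})\in D(H)$$ is the ribbon element. **Proposition.** Define $\lambda_D\in D(H)^*$ and $\Lambda_D\in D(H)$ by $$\lambda_D(f\otimes x)=\beta(l)^{-2}f(\Lambda)\lambda(x)\quad(f\in H^*,\ x\in H),\qquad \Lambda_D=\beta(l)^2\,S^*(\lambda)\otimes S(\Lambda),$$ where $S^*(\lambda)=\lambda\circ S$. Then: 1. $\lambda_D$ is a right integral on $D(H)$, and the set of all right integrals on $D(H)$ is $\mathbb{D}\lambda_D$. 2. $r$ is invertible in $D(H)$, $\lambda_D(r)=\beta(l)^3$ and $\lambda_D(r^{-1})=\beta(l)^{-3}$. 3. $\Lambda_D$ is both a left and a right cointegral of $D(H)$; the set of left cointegrals and the set of right cointegrals of $D(H)$ are both equal to $\mathbb{D}\Lambda_D$. 4. $\lambda_D(\Lambda_D)=1$ and $\mathbf{S}(\Lambda_D)=\Lambda_D$. -/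

import Mathlib

noncomputable section

namespace HopfDouble

open TensorProduct Module Coalgebra

universe u v

section Integrals

variable {D : Type u} {A : Type v} [CommRing D] [AddCommGroup A] [Module D A]
  [CoalgebraStruct D A]

/-- The product of the dual algebra `A*`: `(f h)(x) = ∑ f(x') h(x'')`. -/
def dualMul : Dual D A ⊗[D] Dual D A →ₗ[D] Dual D A :=
  (comul (R := D) (A := A)).dualMap ∘ₗ dualDistrib D A A

/-- `lam` is a right integral: `lam f = f(1) lam` in `A*`, for all `f` in `A*`. -/
def IsRightIntegral [One A] (lam : Dual D A) : Prop :=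
  ∀ f : Dual D A, dualMul (lam ⊗ₜ[D] f) = f 1 • lam

variable (D) in
/-- `c` is a left cointegral: `x c = ε(x) c` for all `x`. -/
def IsLeftCointegral [Mul A] (c : A) : Prop :=
  ∀ x : A, x * c = counit (R := D) x • c

variable (D) in
/-- `c` is a right cointegral: `c x = ε(x) c` for all `x`. -/
def IsRightCointegral [Mul A] (c : A) : Prop :=
  ∀ x : A, c * x = counit (R := D) x • c

/-- The action `f ⇀ a = ∑ f(a'') a'` of `A*` on `A`. -/
def hitLeft (f : Dual D A) : A →ₗ[D] A :=
  (TensorProduct.rid D A).toLinearMap ∘ₗ f.lTensor A ∘ₗ comul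

/-- The action `a ↼ f = ∑ f(a') a''` of `A*` on `A`. -/
def hitRight (f : Dual D A) : A →ₗ[D] A :=
  (TensorProduct.lid D A).toLinearMap ∘ₗ f.rTensor A ∘ₗ comul

end Integrals

section Moduli

variable {D : Type u} {H : Type v} [CommRing D] [Ring H] [HopfAlgebra D H]

/-- The inverse `β ∘ S` of a multiplicative form `β` in the group `G(H*)`. -/
def formInv (β : H →ₐ[D] D) : Dual D H :=
  β.toLinearMap ∘ₗ HopfAlgebra.antipode D

/-- `α` is the modulus attached to the left cointegral `Lam`: `Lam x = α(x) Lam`. -/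
def IsModulusOfCointegral (Lam : H) (α : H →ₐ[D] D) : Prop :=
  ∀ x : H, Lam * x = α x • Lam

/-- `g` is the modulus attached to the right integral `lam`: `f lam = f(g) lam`. -/
def IsModulusOfIntegral (lam : Dual D H) (g : GroupLike D H) : Prop :=
  ∀ f : Dual D H, dualMul (f ⊗ₜ[D] lam) = f (g : H) • lam

/-- `β ∈ G(H*)` and `l ∈ G(H)` are square roots of the moduli `α`, `g` that implement the square
of the antipode.  The elements of `G(H*)` are the multiplicative forms on `H`. -/
structure IsDoubleBalancing (α : H →ₐ[D] D) (g : GroupLike D H)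
    (β : H →ₐ[D] D) (l : GroupLike D H) : Prop where
  sq_form : dualMul (β.toLinearMap ⊗ₜ[D] β.toLinearMap) = α.toLinearMap
  sq_elem : l * l = g
  antipode_sq : ∀ x : H,
    HopfAlgebra.antipode D (HopfAlgebra.antipode D x) =
      (l : H) * hitRight (formInv β) (hitLeft β.toLinearMap x) * ((l⁻¹ : GroupLike D H) : H)

/-- The unit `θ = β(l)` of `D`. -/
def theta (β : H →ₐ[D] D) (l : GroupLike D H) : Dˣ :=
  Units.map (β : H →* D) (GroupLike.toUnits D l)

end Moduli

section Double

variable (D : Type u) (H : Type v) [CommRing D] [Ring H] [HopfAlgebra D H]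

/-- The inverse `S⁻¹` of the antipode of `H` for composition (and `0` if there is none). -/
def antipodeInv : H →ₗ[D] H :=
  Ring.inverse (HopfAlgebra.antipode D : Module.End D H)

/-- The coproduct `f ↦ ∑ f' ⊗ f''` of `H*`, with `f(x y) = ∑ f'(x) f''(y)`: the transpose of the
product of `H`, followed by the inverse of the canonical isomorphism `H* ⊗ H* ≃ (H ⊗ H)*`. -/
def dualComul [Module.Finite D H] [Module.Projective D H] :
    Dual D H →ₗ[D] Dual D H ⊗[D] Dual D H :=
  ((homTensorHomEquiv D H H D D).trans
      (LinearEquiv.congrRight (TensorProduct.lid D D))).symm.toLinearMap ∘ₗ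
    (LinearMap.mul' D H).dualMap

/-- The underlying module `H* ⊗ H` of the quantum double of `H`. -/
def Double : Type (max u v) := Dual D H ⊗[D] H

instance : AddCommGroup (Double D H) := inferInstanceAs (AddCommGroup (Dual D H ⊗[D] H))

instance : Module D (Double D H) := inferInstanceAs (Module D (Dual D H ⊗[D] H))

variable {D H}

/-- The element `f ⊗ x` of the quantum double. -/
def Double.tmul (f : Dual D H) (x : H) : Double D H := f ⊗ₜ[D] x

/-- The unit `ε ⊗ 1`. -/
instance : One (Double D H) := ⟨Double.tmul (counit : H →ₗ[D] D) 1⟩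

variable (D H)

/-- `a ↦ (f ↦ a ⇀ f)`, where `(a ⇀ f)(b) = f(b a)`. -/
def coregLeft : H →ₗ[D] Dual D H →ₗ[D] Dual D H :=
  Dual.transpose (R := D) ∘ₗ (LinearMap.mul D H).flip

/-- `a ↦ (f ↦ f ↼ a)`, where `(f ↼ a)(b) = f(a b)`. -/
def coregRight : H →ₗ[D] Dual D H →ₗ[D] Dual D H :=
  Dual.transpose (R := D) ∘ₗ LinearMap.mul D H

/-- The straightening map `x ⊗ q ↦ ∑ (x' ⇀ q ↼ S⁻¹(x''')) ⊗ x''`: the map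
`x ⊗ q ↦ ∑ x' ⊗ (q ↼ S⁻¹(x''))` followed by `x ⊗ q ↦ ∑ (x' ⇀ q) ⊗ x''`. -/
def cross : H ⊗[D] Dual D H →ₗ[D] Dual D H ⊗[D] H :=
  ((TensorProduct.lift (coregLeft D H)).rTensor H ∘ₗ
    (TensorProduct.rightComm D H H (Dual D H)).toLinearMap ∘ₗ comul.rTensor (Dual D H)) ∘ₗ
  ((TensorProduct.lift (coregRight D H ∘ₗ antipodeInv D H)).lTensor H ∘ₗ
    (TensorProduct.assoc D H H (Dual D H)).toLinearMap ∘ₗ comul.rTensor (Dual D H))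

/-- The bicrossed product `(p ⊗ x)(q ⊗ y) = ∑ p (x' ⇀ q ↼ S⁻¹(x''')) ⊗ x'' y` on `H* ⊗ H`. -/
def bicrossedMul :
    (Dual D H ⊗[D] H) ⊗[D] (Dual D H ⊗[D] H) →ₗ[D] Dual D H ⊗[D] H :=
  TensorProduct.map dualMul (LinearMap.mul' D H) ∘ₗ
    (TensorProduct.assoc D (Dual D H) (Dual D H) (H ⊗[D] H)).symm.toLinearMap ∘ₗ
    ((TensorProduct.assoc D (Dual D H) H H).toLinearMap ∘ₗ
      (cross D H).rTensor H ∘ₗ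
      (TensorProduct.assoc D H (Dual D H) H).symm.toLinearMap).lTensor (Dual D H) ∘ₗ
    (TensorProduct.assoc D (Dual D H) H (Dual D H ⊗[D] H)).toLinearMap

/-- The coproduct `f ⊗ x ↦ ∑ (f'' ⊗ x') ⊗ (f' ⊗ x'')` of `H*ᶜᵒᵖ ⊗ H`. -/
def doubleComul [Module.Finite D H] [Module.Projective D H] :
    Dual D H ⊗[D] H →ₗ[D] (Dual D H ⊗[D] H) ⊗[D] (Dual D H ⊗[D] H) :=
  (TensorProduct.tensorTensorTensorComm D (Dual D H) (Dual D H) H H).toLinearMap ∘ₗ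
    TensorProduct.map
      ((TensorProduct.comm D (Dual D H) (Dual D H)).toLinearMap ∘ₗ dualComul D H) comul

/-- The counit `f ⊗ x ↦ f(1) ε(x)` of `H*ᶜᵒᵖ ⊗ H`. -/
def doubleCounit : Dual D H ⊗[D] H →ₗ[D] D :=
  dualDistrib D (Dual D H) H (Dual.eval D H 1 ⊗ₜ[D] counit)

/-- The product of the double as a linear map. -/
def Double.mulMap : Double D H ⊗[D] Double D H →ₗ[D] Double D H := bicrossedMul D H

instance : Mul (Double D H) := ⟨fun a b => Double.mulMap D H (a ⊗ₜ[D] b)⟩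

instance [Module.Finite D H] [Module.Projective D H] : CoalgebraStruct D (Double D H) where
  comul := doubleComul D H
  counit := doubleCounit D H

/-- The embedding `f ↦ f ⊗ 1` of `H*`. -/
def Double.inclDual : Dual D H →ₗ[D] Double D H :=
  (TensorProduct.mk D (Dual D H) H).flip 1

/-- The embedding `x ↦ ε ⊗ x` of `H`. -/
def Double.incl : H →ₗ[D] Double D H :=
  TensorProduct.mk D (Dual D H) H counit

/-- The antipode `f ⊗ x ↦ (ε ⊗ S(x)) (S*⁻¹(f) ⊗ 1)` of the double. -/
def Double.antipode : Double D H →ₗ[D] Double D H :=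
  (Double.mulMap D H ∘ₗ
    TensorProduct.map (Double.incl D H ∘ₗ HopfAlgebra.antipode D)
      (Double.inclDual D H ∘ₗ (antipodeInv D H).dualMap) ∘ₗ
    (TensorProduct.comm D (Dual D H) H).toLinearMap :
    Dual D H ⊗[D] H →ₗ[D] Double D H)

/-- The canonical element `∑ hⁱ ⊗ hᵢ` of `H* ⊗ H`, with `x = ∑ hⁱ(x) hᵢ` for all `x`. -/
def dualBases [Module.Finite D H] [Module.Projective D H] : Dual D H ⊗[D] H :=
  (dualTensorHomEquiv D H H).symm LinearMap.id

/-- The canonical `R`-matrix `∑ (ε ⊗ hᵢ) ⊗ (hⁱ ⊗ 1)` of the double. -/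
def Double.rMatrix [Module.Finite D H] [Module.Projective D H] : Double D H ⊗[D] Double D H :=
  TensorProduct.map (Double.incl D H) (Double.inclDual D H)
    (TensorProduct.comm D (Dual D H) H (dualBases D H))

/-- The element `u = ∑ S(fᵢ) eᵢ`, where `∑ eᵢ ⊗ fᵢ` is the canonical `R`-matrix. -/
def Double.drinfeldElem [Module.Finite D H] [Module.Projective D H] : Double D H :=
  Double.mulMap D H ((Double.antipode D H).rTensor (Double D H)
    (TensorProduct.comm D (Double D H) (Double D H) (Double.rMatrix D H)))

variable {D H}

/-- The ribbon element `∑ S(fᵢ) eᵢ (β⁻¹ ⊗ l⁻¹)` of the double. -/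
def Double.ribbon [Module.Finite D H] [Module.Projective D H]
    (β : H →ₐ[D] D) (l : GroupLike D H) : Double D H :=
  Double.drinfeldElem D H * Double.tmul (formInv β) ((l⁻¹ : GroupLike D H) : H)

/-- The form `f ⊗ x ↦ β(l)⁻² f(Lam) lam(x)` on the double. -/
def Double.integral (β : H →ₐ[D] D) (l : GroupLike D H) (Lam : H) (lam : Dual D H) :
    Dual D (Double D H) :=
  (((theta β l ^ (-2 : ℤ) : Dˣ) : D) •
      dualDistrib D (Dual D H) H (Dual.eval D H Lam ⊗ₜ[D] lam) : Dual D H ⊗[D] H →ₗ[D] D)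

/-- The element `β(l)² S*(lam) ⊗ S(Lam)` of the double. -/
def Double.cointegral (β : H →ₐ[D] D) (l : GroupLike D H) (Lam : H) (lam : Dual D H) :
    Double D H :=
  ((theta β l ^ (2 : ℤ) : Dˣ) : D) •
    Double.tmul ((HopfAlgebra.antipode D).dualMap lam) (HopfAlgebra.antipode D Lam)

end Double

end HopfDouble

end

/-! Since `H` is finitely generated projective, `Double.toEnd` identifies `D(H)` with `End(H)`,
sending `f ⊗ x` to `b ↦ f(b) x`. In this picture the product is `(FG)(b) = ∑ X'' G(S⁻¹(X''') b''
X')` with `X = F(b')` (`Double.toEnd_mul`, `mulAct`). The claims about the ribbon element and the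
cointegrals become identities between endomorphisms of `H`, checked by Sweedler calculus.

The input from `H` is its Frobenius structure. Shifting factors across `Δ(Λ)` and collapsing with
`λ` gives `∑ λ(S(x)Λ')Λ'' = x`. Hence `S` is bijective, integrals and cointegrals of `H` are unique
up to scalars, `λ(xg) = α(g)λ(S(x))`, `λ(gx) = λ(S(x))`, and the Nakayama automorphism of `λ` is
`S²` twisted by `α` (`IsIntegralPair.apply_antipode_antipode_mul`).

The Drinfeld element corresponds to `S⁻¹`, so `r` is `b ↦ ∑ β⁻¹(b') S⁻¹(b'') l⁻¹`. The formula for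
`S²` makes left multiplication by `r` and by the candidate inverse `b ↦ ∑ β(b'') l b'` explicit, and
the two cancel. As `λ_D` sends `F` to `β(l)⁻² λ(F(Λ))`, its values on `r` and `r⁻¹` come from the
integral identities together with `α(g) = β(l)⁴`.

The cointegral `Λ_D` is `b ↦ β(l)² λ(S(b)) S(Λ)`. It absorbs multiplication on the left by the
Nakayama formula, and on the right by the exchange rule for `Δ(S(Λ))`. Conversely, multiplying a
cointegral of the double by elements of `H*` and of `H` separately forces both its functional part
and its vector part, by uniqueness in `H`. Right integrals on the double are handled likewise, by
testing against the forms `f ⊗ x ↦ f(b)q(x)`. Finally, `𝐒(Λ_D) = Λ_D` reduces to computing one right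
cointegral of `H`. -/

noncomputable section

namespace HopfDouble

open TensorProduct Module Coalgebra

/-! ### Linearity as a `fun_prop` predicate on plain functions, for the side conditions of Sweedler
sums. -/

section Linearity

variable (D : Type*) [CommRing D] {M N P : Type*} [AddCommMonoid M] [Module D M]
  [AddCommMonoid N] [Module D N] [AddCommMonoid P] [Module D P]

/-- A function between modules is linear. -/
@[fun_prop]
structure Lin (f : M → N) : Prop where
  map_add' : ∀ x y, f (x + y) = f x + f y
  map_smul' : ∀ (c : D) x, f (c • x) = c • f x

variable {D}

/-- The linear map underlying a function that is linear. -/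
def Lin.toLinearMap {f : M → N} (hf : Lin D f) : M →ₗ[D] N :=
  { toFun := f, map_add' := hf.1, map_smul' := hf.2 }

theorem Lin.map_sum {f : M → N} (hf : Lin D f) {ι : Type*} (s : Finset ι) (g : ι → M) :
    f (∑ i ∈ s, g i) = ∑ i ∈ s, f (g i) :=
  _root_.map_sum hf.toLinearMap g s

@[fun_prop] theorem Lin.id' : Lin D (fun x : M => x) := ⟨fun _ _ => rfl, fun _ _ => rfl⟩

@[fun_prop] theorem Lin.comp' {f : N → P} {g : M → N} (hf : Lin D f) (hg : Lin D g) :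
    Lin D (fun x => f (g x)) :=
  ⟨fun x y => by rw [hg.1, hf.1], fun c x => by rw [hg.2, hf.2]⟩

@[fun_prop] theorem Lin.linearMap (f : N →ₗ[D] P) {g : M → N} (hg : Lin D g) :
    Lin D (fun x => f (g x)) :=
  ⟨fun x y => by rw [hg.1, map_add], fun c x => by rw [hg.2, map_smul]⟩

@[fun_prop] theorem Lin.linearMap_apply {f : M → N →ₗ[D] P} (hf : Lin D f) (y : N) :
    Lin D (fun x => f x y) :=
  ⟨fun x y => by rw [hf.1]; rfl, fun c x => by rw [hf.2]; rfl⟩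

@[fun_prop] theorem Lin.smul_const {f : M → D} (hf : Lin D f) (a : N) :
    Lin D (fun x => f x • a) :=
  ⟨fun x y => by rw [hf.1, add_smul], fun c x => by rw [hf.2, smul_eq_mul, mul_smul]⟩

@[fun_prop] theorem Lin.const_smul {f : M → N} (hf : Lin D f) (d : D) :
    Lin D (fun x => d • f x) :=
  ⟨fun x y => by rw [hf.1, smul_add], fun c x => by rw [hf.2, smul_comm]⟩

@[fun_prop] theorem Lin.tmul_const {f : M → N} (hf : Lin D f) (a : P) :
    Lin D (fun x => f x ⊗ₜ[D] a) :=
  ⟨fun x y => by rw [hf.1, add_tmul], fun c x => by rw [hf.2, smul_tmul']⟩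

@[fun_prop] theorem Lin.const_tmul {f : M → N} (hf : Lin D f) (a : P) :
    Lin D (fun x => a ⊗ₜ[D] f x) :=
  ⟨fun x y => by rw [hf.1, tmul_add], fun c x => by rw [hf.2, tmul_smul]⟩

variable {A : Type*} [Ring A] [Algebra D A]

@[fun_prop] theorem Lin.mul_const {f : M → A} (hf : Lin D f) (a : A) :
    Lin D (fun x => f x * a) :=
  ⟨fun x y => by rw [hf.1, add_mul], fun c x => by rw [hf.2, smul_mul_assoc]⟩

@[fun_prop] theorem Lin.const_mul {f : M → A} (hf : Lin D f) (a : A) :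
    Lin D (fun x => a * f x) :=
  ⟨fun x y => by rw [hf.1, mul_add], fun c x => by rw [hf.2, mul_smul_comm]⟩

@[fun_prop] theorem Lin.algHom {B : Type*} [Ring B] [Algebra D B] (φ : A →ₐ[D] B) {f : M → A}
    (hf : Lin D f) : Lin D (fun x => φ (f x)) :=
  ⟨fun x y => by rw [hf.1, map_add], fun c x => by rw [hf.2, map_smul]⟩

end Linearity

/-! ### Sweedler calculus in coalgebras and Hopf algebras. -/

section Sweedler

variable {D H : Type*} [CommRing D] [AddCommGroup H] [Module D H]
  {M N : Type*} [AddCommMonoid M] [AddCommMonoid N]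

section

variable [Module D M]

/-- The linear map on the tensor square given by a function that is linear in both arguments. -/
def liftFun (f : H → H → M) (h₁ : ∀ b, Lin D (fun a => f a b)) (h₂ : ∀ a, Lin D (f a)) :
    H ⊗[D] H →ₗ[D] M :=
  lift (LinearMap.mk₂ D f (fun a a' b => (h₁ b).1 a a') (fun c a b => (h₁ b).2 c a)
    (fun a b b' => (h₂ a).1 b b') (fun c a b => (h₂ a).2 c b))

@[simp] theorem liftFun_tmul (f : H → H → M) (h₁ : ∀ b, Lin D (fun a => f a b))
    (h₂ : ∀ a, Lin D (f a)) (a b : H) : liftFun f h₁ h₂ (a ⊗ₜ b) = f a b := rfl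

end

variable [CoalgebraStruct D H]

variable (D) in
/-- The Sweedler sum `∑ f(x', x'')`. -/
def sw (x : H) (f : H → H → M) : M :=
  ∑ i ∈ (ℛ D x).index, f ((ℛ D x).left i) ((ℛ D x).right i)

theorem map_sw {F : Type*} [FunLike F M N] [AddMonoidHomClass F M N] (φ : F) (x : H)
    (f : H → H → M) : φ (sw D x f) = sw D x (fun a b => φ (f a b)) := map_sum φ _ _

theorem sw_ext {x : H} {f g : H → H → M} (h : ∀ a b, f a b = g a b) : sw D x f = sw D x g := by
  rw [show f = g from funext fun a => funext (h a)]

theorem sw_comm (x y : H) (f : H → H → H → H → M) :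
    sw D x (fun a b => sw D y (fun c d => f a b c d)) =
      sw D y (fun c d => sw D x (fun a b => f a b c d)) := Finset.sum_comm

variable [Module D M] [Module D N]

/-- The sum `sw` uses a chosen representation of `Δ(x)`; bilinearity of `f` makes the value depend
on `Δ(x)` alone. Linearity in `x` and substitution of other expressions for `Δ(x)` rest on this. -/
theorem sw_eq_liftFun (x : H) (f : H → H → M) (h₁ : ∀ b, Lin D (fun a => f a b))
    (h₂ : ∀ a, Lin D (f a)) : sw D x f = liftFun f h₁ h₂ (comul x) := by
  rw [← (ℛ D x).eq, map_sum]; rfl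

theorem sw_tmul (x : H) : sw D x (fun a b => a ⊗ₜ[D] b) = comul x := (ℛ D x).eq

@[fun_prop] theorem Lin.sw_left {f : H → H → M} {g : N → H} (hg : Lin D g)
    (h₁ : ∀ b, Lin D (fun a => f a b)) (h₂ : ∀ a, Lin D (f a)) :
    Lin D (fun y => sw D (g y) f) := by
  simp only [sw_eq_liftFun _ f h₁ h₂]
  fun_prop

@[fun_prop] theorem Lin.sw_right {f : N → H → H → M} (x : H)
    (h : ∀ a b, Lin D (fun y => f y a b)) : Lin D (fun y => sw D x (f y)) :=
  ⟨fun y z => by simp only [sw, (h _ _).1, Finset.sum_add_distrib],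
    fun c y => by simp only [sw, (h _ _).2, Finset.smul_sum]⟩

theorem Lin.map_sw {φ : M → N} (hφ : Lin D φ) (x : H) (f : H → H → M) :
    φ (sw D x f) = sw D x (fun a b => φ (f a b)) := hφ.map_sum _ _

theorem smul_sw (c : D) (x : H) (f : H → H → M) :
    c • sw D x f = sw D x (fun a b => c • f a b) := Finset.smul_sum

theorem sw_tmul_const (x : H) (f : H → H → M) (y : N) :
    sw D x f ⊗ₜ[D] y = sw D x (fun a b => f a b ⊗ₜ[D] y) := sum_tmul _ _ _

theorem tmul_sw (x : H) (f : H → H → M) (y : N) :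
    y ⊗ₜ[D] sw D x f = sw D x (fun a b => y ⊗ₜ[D] f a b) := tmul_sum _ _ _

theorem sw_smul (x : H) (f : H → H → D) (y : N) :
    sw D x f • y = sw D x (fun a b => f a b • y) := Finset.sum_smul

end Sweedler

section SweedlerCoalgebra

variable {D H : Type*} [CommRing D] [AddCommGroup H] [Module D H] [Coalgebra D H]
  {M N : Type*} [AddCommMonoid M] [Module D M] [AddCommMonoid N] [Module D N]

theorem sw_coassoc (x : H) (f : H → H → H → M) (h₁ : ∀ b c, Lin D (fun a => f a b c))
    (h₂ : ∀ a c, Lin D (fun b => f a b c)) (h₃ : ∀ a b, Lin D (fun c => f a b c)) :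
    sw D x (fun a b => sw D a (fun a₁ a₂ => f a₁ a₂ b)) =
      sw D x (fun a b => sw D b (fun b₁ b₂ => f a b₁ b₂)) := by
  have key := coassoc_apply (R := D) x
  rw [← sw_tmul x, map_sw, map_sw, map_sw] at key
  simp only [LinearMap.rTensor_tmul, LinearMap.lTensor_tmul] at key
  let F : H ⊗[D] (H ⊗[D] H) →ₗ[D] M :=
    lift (Lin.toLinearMap (f := fun a => liftFun (f a) (fun c => h₂ a c) (fun b => h₃ a b))
      ⟨fun a a' => by ext b c; exact (h₁ b c).1 a a', fun d a => by ext b c; exact (h₁ b c).2 d a⟩)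
  have := congrArg F key
  rw [map_sw, map_sw] at this
  convert this using 1 <;> refine sw_ext fun a b => ?_
  · rw [← sw_tmul a, (Lin.tmul_const Lin.id' b).map_sw, map_sw, map_sw]; rfl
  · rw [← sw_tmul b, (Lin.const_tmul Lin.id' a).map_sw, map_sw]; rfl

theorem sw_counit_left (x : H) (f : H → M) (hf : Lin D f) :
    sw D x (fun a b => counit (R := D) a • f b) = f x := by
  have h := sum_counit_smul (R := D) (ℛ D x)
  conv_rhs => rw [← h, hf.map_sum]
  simp only [hf.2]; rfl

theorem sw_counit_right (x : H) (f : H → M) (hf : Lin D f) :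
    sw D x (fun a b => counit (R := D) b • f a) = f x := by
  have h := congrArg (TensorProduct.rid D H) (sum_tmul_counit_eq (R := D) (ℛ D x))
  simp only [map_sum, rid_tmul, one_smul] at h
  conv_rhs => rw [← h, hf.map_sum]
  simp only [hf.2]; rfl

/-- Contraction of the two left factors of an iterated coproduct. -/
theorem sw_contract_left {u : H} {m : H → H → H}
    (hm : ∀ x, sw D x m = counit (R := D) x • u)
    (h₁ : ∀ b, Lin D (fun a => m a b)) (h₂ : ∀ a, Lin D (m a)) (x : H) (f : H → H → M)
    (hf₁ : ∀ b, Lin D (fun a => f a b)) (hf₂ : ∀ a, Lin D (f a)) :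
    sw D x (fun a b => sw D b (fun c d => f (m a c) d)) = f u x := by
  rw [← sw_coassoc x (fun a c d => f (m a c) d)]
  · rw [← sw_counit_left x (f u) (hf₂ u)]
    refine sw_ext fun a b => ?_
    rw [← (hf₁ b).map_sw, hm, (hf₁ b).2]
  · intro b c; exact (hf₁ c).comp' (h₁ b)
  · intro b c; exact (hf₁ c).comp' (h₂ b)
  · intro a b; exact hf₂ _

/-- Contraction of the two right factors of an iterated coproduct. -/
theorem sw_contract_right {u : H} {m : H → H → H}
    (hm : ∀ x, sw D x m = counit (R := D) x • u)
    (x : H) (f : H → H → M)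
    (hf₁ : ∀ b, Lin D (fun a => f a b)) (hf₂ : ∀ a, Lin D (f a)) :
    sw D x (fun a b => sw D b (fun c d => f a (m c d))) = f x u := by
  rw [← sw_counit_right x (fun y => f y u) (hf₁ u)]
  refine sw_ext fun a b => ?_
  rw [← (hf₂ a).map_sw, hm, (hf₂ a).2]

end SweedlerCoalgebra

section SweedlerHopf

open HopfAlgebra

variable {D H : Type*} [CommRing D] [Ring H] [HopfAlgebra D H]
  {M N : Type*} [AddCommMonoid M] [Module D M] [AddCommMonoid N] [Module D N]

theorem sw_mul (x y : H) (f : H → H → M) (h₁ : ∀ b, Lin D (fun a => f a b))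
    (h₂ : ∀ a, Lin D (f a)) :
    sw D (x * y) f = sw D x (fun a b => sw D y (fun c d => f (a * c) (b * d))) := by
  rw [sw_eq_liftFun _ f h₁ h₂, Bialgebra.comul_mul, ← sw_tmul x, ← sw_tmul y]
  rw [(Lin.mul_const (D := D) Lin.id' _).map_sw, map_sw]
  refine sw_ext fun a b => ?_
  rw [(Lin.const_mul (D := D) Lin.id' _).map_sw, map_sw]
  refine sw_ext fun c d => ?_
  rw [Algebra.TensorProduct.tmul_mul_tmul, liftFun_tmul]

theorem sw_groupLike {x : H} (hx : IsGroupLikeElem D x) (f : H → H → M)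
    (h₁ : ∀ b, Lin D (fun a => f a b)) (h₂ : ∀ a, Lin D (f a)) : sw D x f = f x x := by
  rw [sw_eq_liftFun _ f h₁ h₂, hx.comul_eq_tmul_self, liftFun_tmul]

theorem sw_smul_arg (c : D) (x : H) (f : H → H → M) (h₁ : ∀ b, Lin D (fun a => f a b))
    (h₂ : ∀ a, Lin D (f a)) : sw D (c • x) f = c • sw D x f := by
  rw [sw_eq_liftFun _ f h₁ h₂, sw_eq_liftFun _ f h₁ h₂, map_smul, map_smul]

theorem sw_antipode_mul_self (x : H) :
    sw D x (fun a b => antipode D a * b) = counit (R := D) x • (1 : H) :=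
  sum_antipode_mul_eq_smul (ℛ D x)

theorem sw_mul_antipode_self (x : H) :
    sw D x (fun a b => a * antipode D b) = counit (R := D) x • (1 : H) :=
  sum_mul_antipode_eq_smul (ℛ D x)

/-- Both sides are convolution inverses of `Δ` in `Hom(H, H ⊗ H)`: the flipped `(S ⊗ S)Δ` is a left
inverse by contracting twice, and `Δ ∘ S` is a right inverse. The two therefore agree. -/
theorem comul_antipode_eq (x : H) :
    comul (antipode D x) = sw D x (fun a b => antipode D b ⊗ₜ[D] antipode D a) := by
  have h₁ : WithConv.toConv ((TensorProduct.comm D H H).toLinearMap ∘ₗ TensorProduct.map (antipode D) (antipode D) ∘ₗ comul) *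
      WithConv.toConv (comul (R := D) (A := H)) = 1 := by
    apply WithConv.ofConv_injective
    ext x
    have : ∀ y : H, ((TensorProduct.comm D H H).toLinearMap ∘ₗ TensorProduct.map (antipode D) (antipode D) ∘ₗ comul) y =
        sw D y (fun a b => antipode D b ⊗ₜ[D] antipode D a) := by
      intro y
      simp only [LinearMap.comp_apply]
      rw [← sw_tmul y, map_sw, map_sw]
      rfl
    rw [(ℛ D x).convMul_apply]
    change sw D x (fun a b => ((TensorProduct.comm D H H).toLinearMap ∘ₗ TensorProduct.map (antipode D) (antipode D) ∘ₗ comul) a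
      * comul b) = algebraMap D (H ⊗[D] H) (counit x)
    simp only [this]
    have e1 : ∀ a b : H, sw D a (fun a₁ a₂ => antipode D a₂ ⊗ₜ[D] antipode D a₁) * comul (R := D) b =
      sw D a (fun a₁ a₂ => sw D b (fun b₁ b₂ => (antipode D a₂ * b₁) ⊗ₜ[D] (antipode D a₁ * b₂))) := by
      intro a b
      rw [(Lin.mul_const (D := D) Lin.id' _).map_sw]
      refine sw_ext fun c d => ?_
      rw [← sw_tmul b, (Lin.const_mul (D := D) Lin.id' _).map_sw]
      simp only [Algebra.TensorProduct.tmul_mul_tmul]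
    simp only [e1]
    rw [sw_coassoc x (fun a b c => sw D c (fun c₁ c₂ => (antipode D b * c₁) ⊗ₜ[D] (antipode D a * c₂)))]
    · have e2 : ∀ a b : H, sw D b (fun c d => sw D d (fun e f => (antipode D c * e) ⊗ₜ[D] (antipode D a * f)))
          = (1 : H) ⊗ₜ[D] (antipode D a * b) := by
        intro a b
        exact sw_contract_left sw_antipode_mul_self (by intro b; fun_prop) (by intro a; fun_prop)
          b (fun p q => p ⊗ₜ[D] (antipode D a * q)) (by fun_prop) (by fun_prop)
      simp only [e2]
      rw [← (Lin.const_tmul Lin.id' (1 : H)).map_sw (φ := fun y => (1 : H) ⊗ₜ[D] y),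
        sw_antipode_mul_self, tmul_smul, Algebra.algebraMap_eq_smul_one]
      rfl
    · fun_prop
    · fun_prop
    · fun_prop
  have h₂ := left_inv_eq_right_inv h₁ (LinearMap.comul_right_inv (R := D) (C := H))
  have h₃ := congrArg (fun φ => φ.ofConv x) h₂
  simp only [LinearMap.comp_apply] at h₃
  rw [← sw_tmul x, map_sw, map_sw] at h₃
  exact h₃.symm

theorem sw_antipode (x : H) (f : H → H → M) (h₁ : ∀ b, Lin D (fun a => f a b))
    (h₂ : ∀ a, Lin D (f a)) :
    sw D (antipode D x) f = sw D x (fun a b => f (antipode D b) (antipode D a)) := by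
  rw [sw_eq_liftFun _ f h₁ h₂, comul_antipode_eq, map_sw]
  rfl

end SweedlerHopf

/-! ### Moving factors across the coproduct of a cointegral. -/

section CointegralShift

open HopfAlgebra

variable {D H : Type*} [CommRing D] [Ring H] [HopfAlgebra D H]
  {M : Type*} [AddCommMonoid M] [Module D M]

/-- `∑ Λ' ⊗ xΛ'' = ∑ S(x)Λ' ⊗ Λ''` for a left cointegral. -/
theorem IsLeftCointegral.sw_mul_right {c : H} (hc : IsLeftCointegral D c) (x : H)
    (f : H → H → M) (h₁ : ∀ b, Lin D (fun a => f a b)) (h₂ : ∀ a, Lin D (f a)) :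
    sw D c (fun a b => f a (x * b)) = sw D c (fun a b => f (antipode D x * a) b) := by
  -- The common value is `∑ S(x')(x''c)' ⊗ (x''c)''`: it collapses through `x''c = ε(x'')c`, or
  -- expands so that `S(x')x''` contracts.
  have e : sw D x (fun p q => sw D (q * c) (fun a b => f (antipode D p * a) b)) =
      sw D c (fun a b => f (antipode D x * a) b) := by
    rw [← sw_counit_right x (fun p => sw D c (fun a b => f (antipode D p * a) b)) (by fun_prop)]
    refine sw_ext fun p q => ?_
    rw [hc q, sw_smul_arg _ _ _ (by fun_prop) (by fun_prop)]
  rw [← e]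
  have e' : ∀ p q, sw D (q * c) (fun a b => f (antipode D p * a) b) =
      sw D q (fun r s => sw D c (fun a b => f (antipode D p * r * a) (s * b))) := by
    intro p q
    rw [sw_mul _ _ _ (by fun_prop) (by fun_prop)]
    simp only [mul_assoc]
  simp only [e']
  rw [sw_contract_left (sw_antipode_mul_self (D := D)) (by fun_prop) (by fun_prop) x
    (fun u s => sw D c (fun a b => f (u * a) (s * b))) (by fun_prop) (by fun_prop)]
  simp only [one_mul]

/-- `∑ cx ⊗ c'' = ∑ χ(x') c' ⊗ c'' S(x'')` if `c x = χ(x) c` for all `x`. -/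
theorem sw_mul_left_of_mul_eq_smul {c : H} {χ : H →ₐ[D] D} (hc : ∀ x, c * x = χ x • c) (x : H)
    (f : H → H → M) (h₁ : ∀ b, Lin D (fun a => f a b)) (h₂ : ∀ a, Lin D (f a)) :
    sw D c (fun a b => f (a * x) b) =
      sw D x (fun p q => χ p • sw D c (fun a b => f a (b * antipode D q))) := by
  have e : ∀ p q, χ p • sw D c (fun a b => f a (b * antipode D q)) =
      sw D p (fun r s => sw D c (fun a b => f (a * r) (b * (s * antipode D q)))) := by
    intro p q
    rw [← sw_smul_arg _ _ _ (by fun_prop) (by fun_prop), ← hc,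
      sw_mul _ _ _ (by fun_prop) (by fun_prop), sw_comm]
    simp only [mul_assoc]
  simp only [e]
  rw [sw_coassoc x (fun p q r => sw D c (fun a b => f (a * p) (b * (q * antipode D r))))
    (by fun_prop) (by fun_prop) (by fun_prop)]
  rw [sw_contract_right (sw_mul_antipode_self (D := D)) x
    (fun r u => sw D c (fun a b => f (a * r) (b * u))) (by fun_prop) (by fun_prop)]
  simp only [mul_one]

/-- `∑ c'x ⊗ c'' = ∑ c' ⊗ c'' S(x)` for a right cointegral. -/
theorem IsRightCointegral.sw_mul_left {c : H} (hc : IsRightCointegral D c) (x : H)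
    (f : H → H → M) (h₁ : ∀ b, Lin D (fun a => f a b)) (h₂ : ∀ a, Lin D (f a)) :
    sw D c (fun a b => f (a * x) b) = sw D c (fun a b => f a (b * antipode D x)) := by
  rw [sw_mul_left_of_mul_eq_smul (χ := Bialgebra.counitAlgHom D H) hc x f h₁ h₂]
  exact sw_counit_left x (fun q => sw D c (fun a b => f a (b * antipode D q))) (by fun_prop)

end CointegralShift

/-! ### Frobenius structure of `H`: uniqueness of left integrals, bijectivity of the antipode. -/

section IntegralPair

open HopfAlgebra

variable {D H : Type*} [CommRing D] [Ring H] [HopfAlgebra D H]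
  {M : Type*} [AddCommMonoid M] [Module D M]

theorem groupLike_mul_inv (g : GroupLike D H) : (g : H) * ((g⁻¹ : GroupLike D H) : H) = 1 := by
  rw [← GroupLike.val_mul, mul_inv_cancel, GroupLike.val_one]

theorem groupLike_inv_mul (g : GroupLike D H) : ((g⁻¹ : GroupLike D H) : H) * (g : H) = 1 := by
  rw [← GroupLike.val_mul, inv_mul_cancel, GroupLike.val_one]

/-- A left cointegral `Λ` and a right integral `λ` with `λ(Λ) = λ(S(Λ)) = 1`, together with
their moduli, in terms of elements. -/
structure IsIntegralPair (Lam : H) (lam : Dual D H) (α : H →ₐ[D] D) (g : GroupLike D H) :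
    Prop where
  left : IsLeftCointegral D Lam
  mul : ∀ x : H, Lam * x = α x • Lam
  sw_left : ∀ x : H, sw D x (fun a b => lam a • b) = lam x • (1 : H)
  sw_right : ∀ x : H, sw D x (fun a b => lam b • a) = lam x • (g : H)
  apply_self : lam Lam = 1
  apply_antipode : lam (antipode D Lam) = 1

variable {Lam : H} {lam : Dual D H} {α : H →ₐ[D] D} {g : GroupLike D H}
  (h : IsIntegralPair Lam lam α g)

include h

theorem IsIntegralPair.sw_left_apply (x : H) (f : H → M) (hf : Lin D f) :
    sw D x (fun a b => lam a • f b) = lam x • f 1 := by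
  rw [← hf.2, ← h.sw_left, hf.map_sw]
  exact sw_ext fun a b => (hf.2 _ _).symm

theorem IsIntegralPair.sw_right_apply (x : H) (f : H → M) (hf : Lin D f) :
    sw D x (fun a b => lam b • f a) = lam x • f g := by
  rw [← hf.2, ← h.sw_right, hf.map_sw]
  exact sw_ext fun a b => (hf.2 _ _).symm

/-- The shift rule turns `λ(S(x)Λ')Λ''` into `λ(Λ')xΛ''`, and the integral property collapses this
to `λ(Λ)x = x`. This is the dual bases formula behind the uniqueness results and the inverse of `S`.
-/
theorem IsIntegralPair.sw_antipode_mul_smul (x : H) (f : H → M) (hf : Lin D f) :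
    sw D Lam (fun a b => lam (antipode D x * a) • f b) = f x := by
  rw [← h.left.sw_mul_right x (fun a b => lam a • f b) (by fun_prop) (by fun_prop),
    h.sw_left_apply _ (fun b => f (x * b)) (by fun_prop), h.apply_self, one_smul, mul_one]

/-- Linear maps that are left integrals are determined by their value at `Λ`. -/
theorem IsIntegralPair.eq_smul_of_left (f : H → M) (hf : Lin D f)
    (hf' : ∀ (q : Dual D H) (x : H), sw D x (fun a b => q a • f b) = q 1 • f x) (x : H) :
    f x = lam (antipode D x) • f Lam := by
  rw [← h.sw_antipode_mul_smul x f hf]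
  -- Testing against `q = λ(S(x) ·)` at `Λ` makes the left side the dual bases expansion of `f x`,
  -- while `q(1) = λ(S(x))`.
  have e := hf' (lam ∘ₗ LinearMap.mulLeft D (antipode D x)) Lam
  simpa using e

/-- Left integrals are multiples of `λ ∘ S`. -/
theorem IsIntegralPair.eq_mul_of_left {f : H → D} (hf : Lin D f)
    (hf' : ∀ x, sw D x (fun a b => f b • a) = f x • (1 : H)) (x : H) :
    f x = lam (antipode D x) * f Lam := by
  refine h.eq_smul_of_left f hf (fun q x => ?_) x
  have e := congrArg q (hf' x)
  rw [map_sw, map_smul] at e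
  simpa only [map_smul, smul_eq_mul, mul_comm] using e

/-- Translating by `g` turns the right integral `λ` into the left integral `x ↦ λ(xg)`. Uniqueness
applies, with value `λ(Λg) = α(g)` at `Λ`. -/
theorem IsIntegralPair.apply_mul_groupLike (x : H) : lam (x * g) = α g * lam (antipode D x) := by
  have e := h.eq_mul_of_left (f := fun x => lam (x * g)) (by fun_prop) (fun x => ?_) x
  · rw [e, h.mul, map_smul, h.apply_self, smul_eq_mul, mul_one, mul_comm]
  · have e := h.sw_right_apply (x * g) (fun a => a * ((g⁻¹ : GroupLike D H) : H)) (by fun_prop)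
    rw [sw_mul _ _ _ (by fun_prop) (by fun_prop)] at e
    have e' : ∀ a b : H, sw D (g : H)
        (fun c d => lam (b * d) • (a * c * ((g⁻¹ : GroupLike D H) : H))) =
        lam (b * g) • (a * g * ((g⁻¹ : GroupLike D H) : H)) := fun a b =>
      sw_groupLike g.2 (fun c d => lam (b * d) • (a * c * ((g⁻¹ : GroupLike D H) : H)))
        (by fun_prop) (by fun_prop)
    simp only [e'] at e
    simpa only [mul_assoc, groupLike_mul_inv, mul_one] using e

/-- The dual bases formula exhibits `V(y) = ∑ λ(yΛ')Λ''` as a left inverse of `S`. Thus `V` is a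
surjective endomorphism of a finite module, hence injective, and `S` is also a right inverse of `V`.
-/
theorem IsIntegralPair.isUnit_antipode [Module.Finite D H] :
    IsUnit (antipode D : Module.End D H) := by
  let V : Module.End D H :=
    (show Lin D (fun y => sw D Lam (fun a b => lam (y * a) • b)) by fun_prop).toLinearMap
  have hV : V * (antipode D : Module.End D H) = 1 := by
    ext x
    exact h.sw_antipode_mul_smul x (fun b => b) (by fun_prop)
  have hinj : Function.Injective V :=
    OrzechProperty.injective_of_surjective_endomorphism V fun x =>
      ⟨antipode D x, LinearMap.congr_fun hV x⟩
  refine isUnit_iff_exists.2 ⟨V, ?_, hV⟩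
  ext y
  apply hinj
  exact LinearMap.congr_fun hV (V y)

end IntegralPair

/-! ### The inverse antipode and its Sweedler identities. -/

section AntipodeInv

open HopfAlgebra

variable {D H : Type*} [CommRing D] [Ring H] [HopfAlgebra D H]
  {M : Type*} [AddCommMonoid M] [Module D M]
  (hS : IsUnit (antipode D : Module.End D H))

include hS

theorem antipode_antipodeInv (x : H) : antipode D (antipodeInv D H x) = x :=
  LinearMap.congr_fun (Ring.mul_inverse_cancel _ hS) x

theorem antipodeInv_antipode (x : H) : antipodeInv D H (antipode D x) = x :=
  LinearMap.congr_fun (Ring.inverse_mul_cancel _ hS) x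

theorem antipode_injective : Function.Injective (antipode D : H → H) :=
  Function.LeftInverse.injective (antipodeInv_antipode hS)

theorem antipodeInv_mul (x y : H) :
    antipodeInv D H (x * y) = antipodeInv D H y * antipodeInv D H x := by
  apply antipode_injective hS
  rw [antipode_mul_antidistrib]
  simp only [antipode_antipodeInv hS]

theorem antipodeInv_one : antipodeInv D H 1 = 1 := by
  apply antipode_injective hS
  rw [antipode_antipodeInv hS, antipode_one]

theorem counit_antipodeInv (x : H) : counit (R := D) (antipodeInv D H x) = counit x := by
  rw [← counit_antipode, antipode_antipodeInv hS]

theorem sw_antipodeInv (x : H) (f : H → H → M) (h₁ : ∀ b, Lin D (fun a => f a b))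
    (h₂ : ∀ a, Lin D (f a)) :
    sw D (antipodeInv D H x) f =
      sw D x (fun a b => f (antipodeInv D H b) (antipodeInv D H a)) := by
  conv_rhs => rw [← antipode_antipodeInv hS x]
  rw [sw_antipode _ _ (by fun_prop) (by fun_prop)]
  simp only [antipodeInv_antipode hS]

theorem sw_antipodeInv_mul_self (x : H) :
    sw D x (fun a b => antipodeInv D H b * a) = counit (R := D) x • (1 : H) := by
  apply antipode_injective hS
  rw [map_sw, map_smul, antipode_one, ← sw_antipode_mul_self]
  simp only [antipode_mul_antidistrib, antipode_antipodeInv hS]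

theorem sw_mul_antipodeInv_self (x : H) :
    sw D x (fun a b => b * antipodeInv D H a) = counit (R := D) x • (1 : H) := by
  apply antipode_injective hS
  rw [map_sw, map_smul, antipode_one, ← sw_mul_antipode_self]
  simp only [antipode_mul_antidistrib, antipode_antipodeInv hS]

theorem antipodeInv_groupLike (g : GroupLike D H) :
    antipodeInv D H (g : H) = ((g⁻¹ : GroupLike D H) : H) := by
  apply antipode_injective hS
  rw [antipode_antipodeInv hS, GroupLike.val_inv, g.2.antipode_antipode]

end AntipodeInv

/-! ### Multiplicative forms and their convolution inverses. -/

section AlgHom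

open HopfAlgebra

variable {D H : Type*} [CommRing D] [Ring H] [HopfAlgebra D H]
  {M : Type*} [AddCommMonoid M] [Module D M]

/-- The forms `φ` and `φ ∘ S²` are both convolution inverses of `φ ∘ S`. The proof evaluates `∑
φ(S²(x')) φ(S(x'')) φ(x''')` by contracting either pair of neighbours. -/
theorem algHom_antipode_antipode (φ : H →ₐ[D] D) (x : H) :
    φ (antipode D (antipode D x)) = φ x := by
  have e₁ := sw_contract_left (sw_antipode_mul_self (D := D)) (by fun_prop) (by fun_prop) x
    (fun u d => φ (antipode D u) * φ d) (by fun_prop) (by fun_prop)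
  have e₂ := sw_contract_right (sw_antipode_mul_self (D := D)) x
    (fun a u => φ (antipode D (antipode D a)) * φ u) (by fun_prop) (by fun_prop)
  simp only [antipode_one, map_one, one_mul, mul_one] at e₁ e₂
  rw [← e₁, ← e₂]
  refine sw_ext fun a b => sw_ext fun c d => ?_
  rw [antipode_mul_antidistrib, map_mul, map_mul]
  ring

theorem sw_algHom_antipode_smul_left (φ : H →ₐ[D] D) (x : H) (f : H → M) (hf : Lin D f) :
    sw D x (fun a b => sw D b (fun c d => (φ (antipode D a) * φ c) • f d)) = f x := by
  have e := sw_contract_left (sw_antipode_mul_self (D := D)) (by fun_prop) (by fun_prop) x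
    (fun u d => φ u • f d) (by fun_prop) (by fun_prop)
  simpa only [map_mul, map_one, one_smul] using e

theorem sw_algHom_smul_antipode_left (φ : H →ₐ[D] D) (x : H) (f : H → M) (hf : Lin D f) :
    sw D x (fun a b => sw D b (fun c d => (φ a * φ (antipode D c)) • f d)) = f x := by
  have e := sw_contract_left (sw_mul_antipode_self (D := D)) (by fun_prop) (by fun_prop) x
    (fun u d => φ u • f d) (by fun_prop) (by fun_prop)
  simpa only [map_mul, map_one, one_smul] using e

theorem sw_algHom_antipode_smul_right (φ : H →ₐ[D] D) (x : H) (f : H → M) (hf : Lin D f) :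
    sw D x (fun a b => sw D b (fun c d => (φ (antipode D c) * φ d) • f a)) = f x := by
  have e := sw_contract_right (sw_antipode_mul_self (D := D)) x
    (fun a u => φ u • f a) (by fun_prop) (by fun_prop)
  simpa only [map_mul, map_one, one_smul] using e

theorem sw_algHom_smul_antipode_right (φ : H →ₐ[D] D) (x : H) (f : H → M) (hf : Lin D f) :
    sw D x (fun a b => sw D b (fun c d => (φ c * φ (antipode D d)) • f a)) = f x := by
  have e := sw_contract_right (sw_mul_antipode_self (D := D)) x
    (fun a u => φ u • f a) (by fun_prop) (by fun_prop)
  simpa only [map_mul, map_one, one_smul] using e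

end AlgHom

/-! ### Uniqueness of cointegrals and right integrals, and the Nakayama automorphism of `λ`. -/

section Nakayama

open HopfAlgebra

variable {D H : Type*} [CommRing D] [Ring H] [HopfAlgebra D H]
  {M : Type*} [AddCommMonoid M] [Module D M]
  {Lam : H} {lam : Dual D H} {α : H →ₐ[D] D} {g : GroupLike D H}

namespace IsIntegralPair

variable [Module.Finite D H] (h : IsIntegralPair Lam lam α g)

include h

theorem sw_antipodeInv_mul (x : H) (f : H → H → M) (h₁ : ∀ b, Lin D (fun a => f a b))
    (h₂ : ∀ a, Lin D (f a)) :
    sw D Lam (fun a b => f a (antipodeInv D H x * b)) = sw D Lam (fun a b => f (x * a) b) := by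
  rw [h.left.sw_mul_right _ f h₁ h₂, antipode_antipodeInv h.isUnit_antipode]

theorem sw_mul_smul (x : H) (f : H → M) (hf : Lin D f) :
    sw D Lam (fun a b => lam (x * a) • f b) = f (antipodeInv D H x) := by
  rw [← h.sw_antipode_mul_smul (antipodeInv D H x) f hf,
    antipode_antipodeInv h.isUnit_antipode]

/-- The antipode of the left cointegral is a right cointegral. -/
theorem isRightCointegral_antipode {c : H} (hc : IsLeftCointegral D c) :
    IsRightCointegral D (antipode D c) := by
  intro x
  rw [← antipode_antipodeInv h.isUnit_antipode x, ← antipode_mul_antidistrib, hc, map_smul,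
    counit_antipode]

theorem isLeftCointegral_antipodeInv {c : H} (hc : IsRightCointegral D c) :
    IsLeftCointegral D (antipodeInv D H c) := by
  intro x
  apply antipode_injective h.isUnit_antipode
  rw [antipode_mul_antidistrib, antipode_antipodeInv h.isUnit_antipode, hc, map_smul,
    antipode_antipodeInv h.isUnit_antipode, counit_antipode]

/-- In the dual bases formula for `c`, the right cointegral `S(c)` absorbs `Λ'`, leaving `∑ λ(S(c))
ε(Λ')Λ''`. -/
theorem eq_smul_of_isLeftCointegral {c : H} (hc : IsLeftCointegral D c) :
    c = lam (antipode D c) • Lam := by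
  have e := h.sw_antipode_mul_smul c (fun b => b) (by fun_prop)
  have hc' : ∀ a, antipode D c * a = counit (R := D) a • antipode D c :=
    h.isRightCointegral_antipode hc
  simp only [hc', map_smul, smul_eq_mul] at e
  have e₂ := sw_counit_left (D := D) Lam (fun b => lam (antipode D c) • b) (by fun_prop)
  simp only [smul_smul] at e₂
  exact e.symm.trans e₂

theorem eq_smul_of_isRightCointegral {c : H} (hc : IsRightCointegral D c) :
    c = lam c • antipode D Lam := by
  have e := congrArg (antipode D)
    (h.eq_smul_of_isLeftCointegral (h.isLeftCointegral_antipodeInv hc))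
  rwa [map_smul, antipode_antipodeInv h.isUnit_antipode] at e

theorem mul_antipode (x : H) : x * antipode D Lam = α (antipode D x) • antipode D Lam := by
  conv_lhs => rw [← antipode_antipodeInv h.isUnit_antipode x, ← antipode_mul_antidistrib, h.mul,
    map_smul, ← algHom_antipode_antipode, antipode_antipodeInv h.isUnit_antipode]

/-- `∑ λ(X'x) X'' = S(x)` for `X = S(Λ)`. -/
theorem sw_antipode_smul_left (x : H) (f : H → M) (hf : Lin D f) :
    sw D (antipode D Lam) (fun a b => lam (a * x) • f b) = f (antipode D x) := by
  rw [(h.isRightCointegral_antipode h.left).sw_mul_left x (fun a b => lam a • f b)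
    (by fun_prop) (by fun_prop), h.sw_left_apply _ (fun b => f (b * antipode D x)) (by fun_prop),
    h.apply_antipode, one_smul, one_mul]

/-- `∑ λ(X''x) X' = g S⁻¹(x)` for `X = S(Λ)`. -/
theorem sw_antipode_smul_right (x : H) (f : H → M) (hf : Lin D f) :
    sw D (antipode D Lam) (fun a b => lam (b * x) • f a) = f (g * antipodeInv D H x) := by
  have e := (h.isRightCointegral_antipode h.left).sw_mul_left (antipodeInv D H x)
    (fun a b => lam b • f a) (by fun_prop) (by fun_prop)
  rw [antipode_antipodeInv h.isUnit_antipode] at e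
  rw [← e, h.sw_right_apply _ (fun a => f (a * antipodeInv D H x)) (by fun_prop),
    h.apply_antipode, one_smul]

/-- `λ(x) = λ(g S⁻¹(x))`. -/
theorem apply_mul_antipodeInv (x : H) : lam (g * antipodeInv D H x) = lam x := by
  rw [← h.sw_antipode_smul_right x lam (by fun_prop)]
  simp only [smul_eq_mul, mul_comm (lam (_ * x))]
  have e := h.sw_left_apply (antipode D Lam) (fun b => lam (b * x)) (by fun_prop)
  simpa only [smul_eq_mul, h.apply_antipode, one_mul] using e

theorem apply_groupLike_mul (x : H) : lam (g * x) = lam (antipode D x) := by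
  rw [← h.apply_mul_antipodeInv (antipode D x), antipodeInv_antipode h.isUnit_antipode]

theorem apply_antipodeInv (x : H) : lam (antipodeInv D H x) = lam (x * g) := by
  rw [← h.apply_mul_antipodeInv (x * g), antipodeInv_mul h.isUnit_antipode,
    antipodeInv_groupLike h.isUnit_antipode, ← mul_assoc, groupLike_mul_inv, one_mul]

/-- Right integrals are multiples of `λ`. -/
theorem eq_mul_of_right (f : H → D) (hf : Lin D f)
    (hf' : ∀ (q : Dual D H) (x : H), sw D x (fun a b => f a • q b) = f x • q 1) (x : H) :
    f x = f (antipode D Lam) * lam x := by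
  have hg : (g : H) * antipodeInv D H (antipode D (((g⁻¹ : GroupLike D H) : H) * x)) = x := by
    rw [antipodeInv_antipode h.isUnit_antipode, ← mul_assoc, groupLike_mul_inv, one_mul]
  rw [← hg, h.apply_mul_antipodeInv, ← h.sw_antipode_smul_right _ f hf]
  have e := hf' (lam ∘ₗ LinearMap.mulRight D (antipode D (((g⁻¹ : GroupLike D H) : H) * x)))
    (antipode D Lam)
  simpa [mul_comm] using e

/-- The Nakayama automorphism of `λ`: `λ(S²(y)z) = ∑ α⁻¹(y') λ(z y'')`. -/
theorem apply_antipode_antipode_mul (y z : H) :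
    lam (antipode D (antipode D y) * z) =
      sw D y (fun p q => α (antipode D p) * lam (z * q)) := by
  -- Expanding `z = ∑ λ(wΛ'')Λ'` with `w = S⁻¹(zg⁻¹)` turns both `λ(S²(y)z)` and `λ(zq)` into
  -- expressions in `w`, by shifting across `Δ(Λ)` on either side.
  have hz : z = sw D Lam (fun a b =>
      lam (antipodeInv D H (z * ((g⁻¹ : GroupLike D H) : H)) * b) • a) := by
    rw [h.sw_antipodeInv_mul _ (fun a b => lam b • a) (by fun_prop) (by fun_prop),
      h.sw_right_apply _ (fun a => z * ((g⁻¹ : GroupLike D H) : H) * a) (by fun_prop),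
      h.apply_self, one_smul, mul_assoc, groupLike_inv_mul, mul_one]
  generalize antipodeInv D H (z * ((g⁻¹ : GroupLike D H) : H)) = w at hz
  have e₁ : lam (antipode D (antipode D y) * z) = lam (w * antipode D y) := by
    rw [hz, ← LinearMap.mulLeft_apply (R := D), map_sw, map_sw]
    have e := h.left.sw_mul_right (antipode D y) (fun a b => lam a • lam (w * b))
      (by fun_prop) (by fun_prop)
    rw [h.sw_left_apply _ (fun b => lam (w * (antipode D y * b))) (by fun_prop), h.apply_self,
      one_smul, mul_one] at e
    rw [e]
    refine sw_ext fun a b => ?_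
    rw [map_smul, map_smul, LinearMap.mulLeft_apply, smul_eq_mul, smul_eq_mul, mul_comm]
  have e₂ : ∀ q, lam (z * q) = sw D q (fun r s => α r • lam (w * antipode D s)) := by
    intro q
    have e := sw_mul_left_of_mul_eq_smul h.mul q (fun a b => lam a • lam (w * b))
      (by fun_prop) (by fun_prop)
    have e' : ∀ s : H, sw D Lam (fun a b => lam a • lam (w * (b * antipode D s))) =
        lam (w * antipode D s) := fun s => by
      rw [h.sw_left_apply _ (fun b => lam (w * (b * antipode D s))) (by fun_prop),
        h.apply_self, one_smul, one_mul]
    simp only [e'] at e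
    rw [← e, hz, ← LinearMap.mulRight_apply (R := D), map_sw, map_sw]
    refine sw_ext fun a b => ?_
    rw [map_smul, map_smul, LinearMap.mulRight_apply, smul_eq_mul, smul_eq_mul, mul_comm]
  rw [e₁, ← sw_algHom_antipode_smul_left α y (fun s => lam (w * antipode D s)) (by fun_prop)]
  refine sw_ext fun p q => ?_
  rw [e₂, ← smul_eq_mul, smul_sw]
  simp only [mul_smul]

/-- `∑ X'' ⊗ X' = ∑ g⁻¹S²(X') ⊗ X''` for `X = S(Λ)`. -/
theorem sw_antipode_swap (f : H → H → M) (h₁ : ∀ b, Lin D (fun a => f a b))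
    (h₂ : ∀ a, Lin D (f a)) :
    sw D (antipode D Lam) (fun a b => f b a) =
      sw D (antipode D Lam)
        (fun a b => f (((g⁻¹ : GroupLike D H) : H) * antipode D (antipode D a)) b) := by
  -- By the dual bases expansion of the second slot, it suffices to compare the first slots after
  -- pairing the second with `λ( · p)`. Both then equal `S(p)`, as `g⁻¹S²(gS⁻¹(p)) = S(p)`.
  have hz : ∀ y z, f y z = sw D Lam (fun p q => lam (z * p) • f y (antipode D q)) := by
    intro y z
    rw [h.sw_mul_smul z (fun q => f y (antipode D q)) (by fun_prop),
      antipode_antipodeInv h.isUnit_antipode]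
  have e₁ : ∀ a b, f b a = sw D Lam (fun p q => lam (a * p) • f b (antipode D q)) :=
    fun a b => hz b a
  have e₂ : ∀ a b, f (((g⁻¹ : GroupLike D H) : H) * antipode D (antipode D a)) b =
      sw D Lam (fun p q => lam (b * p) •
        f (((g⁻¹ : GroupLike D H) : H) * antipode D (antipode D a)) (antipode D q)) :=
    fun a b => hz _ b
  rw [sw_ext e₁, sw_ext e₂, sw_comm, sw_comm (antipode D Lam)]
  refine sw_ext fun p q => ?_
  rw [h.sw_antipode_smul_left p (fun b => f b (antipode D q)) (by fun_prop),
    h.sw_antipode_smul_right p (fun a => f (((g⁻¹ : GroupLike D H) : H) *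
      antipode D (antipode D a)) (antipode D q)) (by fun_prop), antipode_mul_antidistrib,
    antipode_mul_antidistrib, g.2.antipode_antipode, antipode_antipodeInv h.isUnit_antipode,
    ← mul_assoc, groupLike_inv_mul, one_mul]

/-- The elements on which `H` acts by `α⁻¹` from the left are the multiples of `S(Λ)`. -/
theorem eq_smul_of_mul_eq {y : H} (hy : ∀ x, x * y = α (antipode D x) • y) :
    y = lam y • antipode D Lam := by
  -- `A` is the twist by `α`, and `B`, the twist by `α⁻¹`, is its left inverse.
  let A : H →ₗ[D] H := (show Lin D (fun z => sw D z (fun p q => α p • q)) by fun_prop).toLinearMap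
  let B : H →ₗ[D] H :=
    (show Lin D (fun z => sw D z (fun p q => α (antipode D p) • q)) by fun_prop).toLinearMap
  have hA : Function.Injective A := by
    refine Function.LeftInverse.injective (g := B) fun z : H => ?_
    change B (sw D z (fun p q : H => α p • q)) = z
    rw [map_sw]
    refine Eq.trans (sw_ext fun p q => ?_)
      (sw_algHom_smul_antipode_left α z (fun y => y) (by fun_prop))
    rw [map_smul]
    change α p • sw D q (fun (r t : H) => α (antipode D r) • t) = _
    rw [smul_sw]
    simp only [smul_smul]
  -- Both sides are `∑ λ(Λ'y)Λ''`: the shift rule gives `S(A y)`, and the hypothesis on `y` gives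
  -- `λ(y)` times a vector independent of `y`. Comparison with the solution `S(Λ)` finishes the
  -- proof.
  have key : ∀ {y : H}, (∀ x, x * y = α (antipode D x) • y) →
      antipode D (A y) = lam y • sw D Lam (fun a b => α (antipode D a) • b) := by
    intro y hy
    have e := sw_mul_left_of_mul_eq_smul h.mul y (fun a b => lam a • b)
      (by fun_prop) (by fun_prop)
    have e' : ∀ s : H, sw D Lam (fun a b => lam a • (b * antipode D s)) = antipode D s :=
      fun s => by
        rw [h.sw_left_apply _ (fun b => b * antipode D s) (by fun_prop),
          h.apply_self, one_smul, one_mul]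
    simp only [e', hy, map_smul, smul_eq_mul] at e
    change antipode D (sw D y (fun p q => α p • q)) = _
    rw [map_sw, smul_sw]
    simp only [map_smul]
    rw [← e]
    refine sw_ext fun a b => ?_
    rw [smul_smul, mul_comm]
  apply hA
  apply antipode_injective h.isUnit_antipode
  rw [key hy, map_smul, map_smul, key h.mul_antipode, h.apply_antipode, one_smul]

end IsIntegralPair
end Nakayama

section DualMul

variable {D A : Type*} [CommRing D] [AddCommGroup A] [Module D A] [CoalgebraStruct D A]

theorem dualMul_tmul_apply (f h : Dual D A) (x : A) :
    dualMul (f ⊗ₜ[D] h) x = sw D x (fun a b => f a * h b) := by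
  change dualDistrib D A A (f ⊗ₜ[D] h) (comul x) = _
  rw [← sw_tmul x, map_sw]
  rfl

theorem hitLeft_apply (f : Dual D A) (x : A) : hitLeft f x = sw D x (fun a b => f b • a) := by
  simp only [hitLeft, LinearMap.comp_apply]
  rw [← sw_tmul x, map_sw, LinearEquiv.coe_coe, map_sw]
  exact sw_ext fun a b => by simp

theorem hitRight_apply (f : Dual D A) (x : A) : hitRight f x = sw D x (fun a b => f a • b) := by
  simp only [hitRight, LinearMap.comp_apply]
  rw [← sw_tmul x, map_sw, LinearEquiv.coe_coe, map_sw]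
  exact sw_ext fun a b => by simp

end DualMul

/-! ### The quantum double as a product on `End(H)`. -/

section Double

open HopfAlgebra

variable {D H : Type*} [CommRing D] [Ring H] [HopfAlgebra D H]
  {M : Type*} [AddCommMonoid M] [Module D M]

/-- The endomorphism `b ↦ ∑ fᵢ(b) xᵢ` of `H` attached to the element `∑ fᵢ ⊗ xᵢ` of the double. -/
def Double.toEnd : Double D H →ₗ[D] H →ₗ[D] H := dualTensorHom D H H

theorem Double.toEnd_tmul (f : Dual D H) (x b : H) :
    Double.toEnd (Double.tmul f x) b = f b • x := rfl

theorem Double.eq_of_tmul {f g : Double D H → M} (hf : Lin D f) (hg : Lin D g)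
    (h : ∀ p x, f (Double.tmul p x) = g (Double.tmul p x)) (a : Double D H) : f a = g a :=
  LinearMap.congr_fun (f := (hf.toLinearMap : Dual D H ⊗[D] H →ₗ[D] M))
    (g := (hg.toLinearMap : Dual D H ⊗[D] H →ₗ[D] M)) (TensorProduct.ext' h) a

theorem coregLeft_apply (a b : H) (f : Dual D H) : coregLeft D H a f b = f (b * a) := rfl

theorem coregRight_apply (a b : H) (f : Dual D H) : coregRight D H a f b = f (a * b) := rfl

theorem cross_tmul (x : H) (q : Dual D H) :
    cross D H (x ⊗ₜ[D] q) = sw D x (fun a b => sw D b (fun c d =>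
      coregLeft D H a (coregRight D H (antipodeInv D H d) q) ⊗ₜ[D] c)) := by
  rw [← sw_coassoc x (fun a c d =>
      coregLeft D H a (coregRight D H (antipodeInv D H d) q) ⊗ₜ[D] c)
      (by fun_prop) (by fun_prop) (by fun_prop)]
  simp only [cross, LinearMap.comp_apply, LinearMap.rTensor_tmul, LinearEquiv.coe_coe]
  rw [← sw_tmul x, (Lin.tmul_const Lin.id' q).map_sw, map_sw, map_sw, map_sw, map_sw, map_sw]
  refine sw_ext fun a b => ?_
  simp only [assoc_tmul, LinearMap.lTensor_tmul, LinearMap.rTensor_tmul, lift.tmul,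
    LinearMap.comp_apply]
  rw [← sw_tmul a, (Lin.tmul_const Lin.id' _).map_sw, map_sw, map_sw]
  exact sw_ext fun c d => by simp

theorem bicrossedMul_tmul (p q : Dual D H) (x y : H) :
    bicrossedMul D H ((p ⊗ₜ[D] x) ⊗ₜ[D] (q ⊗ₜ[D] y)) = sw D x (fun a b => sw D b (fun c d =>
      dualMul (p ⊗ₜ[D] coregLeft D H a (coregRight D H (antipodeInv D H d) q)) ⊗ₜ[D]
        (c * y))) := by
  simp only [bicrossedMul, LinearMap.comp_apply, LinearMap.lTensor_tmul, LinearEquiv.coe_coe,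
    assoc_tmul, assoc_symm_tmul, LinearMap.rTensor_tmul, cross_tmul]
  rw [sw_tmul_const, map_sw, tmul_sw, map_sw, map_sw]
  refine sw_ext fun a b => ?_
  rw [sw_tmul_const, map_sw, tmul_sw, map_sw, map_sw]
  rfl

/-- The action `∑ X'' G(S⁻¹(X''') b X')` that describes the product of the double in terms of
endomorphisms. -/
def mulAct (X b : H) (G : H →ₗ[D] H) : H :=
  sw D X (fun X₁ Y => sw D Y (fun X₂ X₃ => X₂ * G (antipodeInv D H X₃ * b * X₁)))

@[fun_prop] theorem Lin.mulAct_left {N : Type*} [AddCommMonoid N] [Module D N] {f : N → H}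
    (hf : Lin D f) (b : H) (G : H →ₗ[D] H) : Lin D (fun y => mulAct (f y) b G) := by
  unfold mulAct
  fun_prop

@[fun_prop] theorem Lin.mulAct_mid {N : Type*} [AddCommMonoid N] [Module D N] {f : N → H}
    (hf : Lin D f) (X : H) (G : H →ₗ[D] H) : Lin D (fun y => mulAct X (f y) G) := by
  unfold mulAct
  fun_prop

@[fun_prop] theorem Lin.mulAct_right {N : Type*} [AddCommMonoid N] [Module D N] {f : N → H →ₗ[D] H}
    (hf : Lin D f) (X b : H) : Lin D (fun y => mulAct X b (f y)) := by
  unfold mulAct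
  fun_prop

theorem mul_def (a c : Double D H) : a * c = Double.mulMap D H (a ⊗ₜ[D] c) := rfl

/-- On pure tensors, the `H*` product splits `b`, and the coregular actions put `S⁻¹(x''')` before
`b''` and `x'` after it in the argument of `q`. Later products in the double are computed through
this formula. -/
theorem Double.toEnd_mul (a c : Double D H) (b : H) :
    Double.toEnd (a * c) b =
      sw D b (fun b₁ b₂ => mulAct (Double.toEnd a b₁) b₂ (Double.toEnd c)) := by
  refine Double.eq_of_tmul (f := fun a => Double.toEnd (a * c) b) (g := fun a =>
    sw D b (fun b₁ b₂ => mulAct (Double.toEnd a b₁) b₂ (Double.toEnd c))) ?_ (by fun_prop)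
    (fun p x => ?_) a
  · simp only [mul_def]; fun_prop
  refine Double.eq_of_tmul (f := fun c => Double.toEnd (Double.tmul p x * c) b) (g := fun c =>
    sw D b (fun b₁ b₂ => mulAct (Double.toEnd (Double.tmul p x) b₁) b₂ (Double.toEnd c)))
    ?_ (by fun_prop) (fun q y => ?_) c
  · simp only [mul_def]; fun_prop
  change dualTensorHom D H H (bicrossedMul D H ((p ⊗ₜ[D] x) ⊗ₜ[D] (q ⊗ₜ[D] y))) b = _
  rw [bicrossedMul_tmul, map_sw, ← LinearMap.applyₗ_apply_apply (R := D) b, map_sw]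
  have e : ∀ b₁ b₂, mulAct (Double.toEnd (Double.tmul p x) b₁) b₂
      (Double.toEnd (Double.tmul q y)) = sw D x (fun X₁ Y => sw D Y (fun X₂ X₃ =>
        (p b₁ * q (antipodeInv D H X₃ * b₂ * X₁)) • (X₂ * y))) := by
    intro b₁ b₂
    rw [Double.toEnd_tmul, (show Lin D (fun z => mulAct z b₂
      (Double.toEnd (Double.tmul q y))) by fun_prop).2, mulAct, smul_sw]
    refine sw_ext fun _ _ => ?_
    rw [smul_sw]
    refine sw_ext fun _ _ => ?_
    rw [Double.toEnd_tmul, mul_smul_comm, smul_smul]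
  rw [sw_ext e, sw_comm]
  refine sw_ext fun X₁ Y => ?_
  rw [map_sw, map_sw, sw_comm]
  refine sw_ext fun X₂ X₃ => ?_
  rw [LinearMap.applyₗ_apply_apply, dualTensorHom_apply, dualMul_tmul_apply,
    sw_smul]
  simp only [coregLeft_apply, coregRight_apply, mul_assoc]

end Double

section DoubleUnits

open HopfAlgebra

variable {D H : Type*} [CommRing D] [Ring H] [HopfAlgebra D H]

theorem Double.toEnd_incl (x b : H) :
    Double.toEnd (Double.incl D H x) b = counit (R := D) b • x := rfl

theorem Double.toEnd_inclDual (q : Dual D H) (b : H) :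
    Double.toEnd (Double.inclDual D H q) b = q b • (1 : H) := rfl

theorem Double.counit_eq [Module.Finite D H] [Module.Projective D H] (a : Double D H) :
    counit (R := D) a = counit (R := D) (Double.toEnd a (1 : H)) := by
  refine Double.eq_of_tmul (f := fun a => counit (R := D) a)
    (g := fun a => counit (R := D) (Double.toEnd a (1 : H))) (by fun_prop) (by fun_prop)
    (fun p x => ?_) a
  rw [Double.toEnd_tmul, map_smul]
  rfl

theorem Double.toEnd_injective [Module.Finite D H] [Module.Projective D H] :
    Function.Injective (Double.toEnd : Double D H →ₗ[D] H →ₗ[D] H) :=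
  (dualTensorHomEquiv D H H).injective

theorem Double.ext_toEnd [Module.Finite D H] [Module.Projective D H] {a c : Double D H}
    (h : ∀ b, Double.toEnd a b = Double.toEnd c b) : a = c :=
  Double.toEnd_injective (LinearMap.ext h)

/-- The element of the double attached to an endomorphism of `H`. -/
def Double.ofEnd [Module.Finite D H] [Module.Projective D H] (F : H →ₗ[D] H) : Double D H :=
  (dualTensorHomEquiv D H H).symm F

theorem Double.toEnd_ofEnd [Module.Finite D H] [Module.Projective D H] (F : H →ₗ[D] H) :
    Double.toEnd (Double.ofEnd F) = F :=
  (dualTensorHomEquiv D H H).apply_symm_apply F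

theorem Double.toEnd_incl_mul (x : H) (c : Double D H) (b : H) :
    Double.toEnd (Double.incl D H x * c) b = mulAct x b (Double.toEnd c) := by
  rw [Double.toEnd_mul, ← sw_counit_left b (fun b => mulAct x b (Double.toEnd c)) (by fun_prop)]
  refine sw_ext fun b₁ b₂ => ?_
  rw [Double.toEnd_incl, (show Lin D (fun z => mulAct z b₂ (Double.toEnd c)) by fun_prop).2]

theorem mulAct_smul_const (X b : H) (φ : Dual D H) (x : H) :
    mulAct X b (φ.smulRight x) =
      sw D X (fun X₁ Y => sw D Y (fun X₂ X₃ =>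
        φ (antipodeInv D H X₃ * b * X₁) • (X₂ * x))) := by
  refine sw_ext fun X₁ Y => sw_ext fun X₂ X₃ => ?_
  rw [LinearMap.smulRight_apply, mul_smul_comm]

theorem Double.antipode_tmul (f : Dual D H) (x : H) :
    Double.antipode D H (Double.tmul f x) = Double.incl D H (HopfAlgebra.antipode D x) *
      Double.inclDual D H (f ∘ₗ antipodeInv D H) := rfl

variable (hS : IsUnit (HopfAlgebra.antipode D : Module.End D H))

include hS

theorem mulAct_one (b : H) (G : H →ₗ[D] H) : mulAct 1 b G = G b := by
  rw [mulAct, sw_groupLike IsGroupLikeElem.one _ (by fun_prop) (by fun_prop),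
    sw_groupLike IsGroupLikeElem.one _ (by fun_prop) (by fun_prop), antipodeInv_one hS, one_mul,
    one_mul, mul_one]

theorem Double.toEnd_mul_incl (a : Double D H) (x b : H) :
    Double.toEnd (a * Double.incl D H x) b = Double.toEnd a b * x := by
  rw [Double.toEnd_mul]
  have e : ∀ X b : H, mulAct X b (Double.toEnd (Double.incl D H x)) =
      counit (R := D) b • (X * x) := by
    intro X b
    rw [show Double.toEnd (Double.incl D H x) = (counit (R := D)).smulRight x from rfl,
      mulAct_smul_const]
    have e' : ∀ X₁ Y : H, sw D Y (fun X₂ X₃ => counit (R := D) (antipodeInv D H X₃ * b * X₁) •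
        (X₂ * x)) = counit (R := D) X₁ • (counit (R := D) b • (Y * x)) := by
      intro X₁ Y
      rw [← sw_counit_right (D := D) Y (fun Y => Y * x) (by fun_prop), smul_sw, smul_sw]
      refine sw_ext fun X₂ X₃ => ?_
      rw [Bialgebra.counit_mul, Bialgebra.counit_mul, counit_antipodeInv hS, smul_smul, smul_smul]
      ring_nf
    rw [sw_ext e', sw_counit_left X (fun Y => counit (R := D) b • (Y * x)) (by fun_prop)]
  rw [sw_ext fun b₁ b₂ => e _ b₂]
  exact sw_counit_right b (fun b => Double.toEnd a b * x) (by fun_prop)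

theorem Double.mul_one [Module.Finite D H] [Module.Projective D H] (a : Double D H) :
    a * 1 = a :=
  Double.ext_toEnd fun b => by
    rw [show (1 : Double D H) = Double.incl D H 1 from rfl, Double.toEnd_mul_incl hS,
      _root_.mul_one]

theorem Double.toEnd_inclDual_mul (q : Dual D H) (c : Double D H) (b : H) :
    Double.toEnd (Double.inclDual D H q * c) b =
      sw D b (fun b₁ b₂ => q b₁ • Double.toEnd c b₂) := by
  rw [Double.toEnd_mul]
  refine sw_ext fun b₁ b₂ => ?_
  rw [Double.toEnd_inclDual, (show Lin D (fun z => mulAct z b₂ (Double.toEnd c)) by fun_prop).2,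
    mulAct_one hS]

/-- The element is `∑ (hⁱ ∘ S⁻¹) ⊗ hᵢ`, and `∑ hⁱ ⊗ hᵢ` is the identity endomorphism. -/
theorem Double.toEnd_drinfeldElem [Module.Finite D H] [Module.Projective D H] (b : H) :
    Double.toEnd (Double.drinfeldElem D H) b = antipodeInv D H b := by
  let L : Double D H →ₗ[D] Double D H :=
    Double.mulMap D H ∘ₗ (Double.antipode D H).rTensor (Double D H) ∘ₗ
      (TensorProduct.comm D (Double D H) (Double D H)).toLinearMap ∘ₗ
      TensorProduct.map (Double.incl D H) (Double.inclDual D H) ∘ₗ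
      (TensorProduct.comm D (Dual D H) H).toLinearMap
  have hL : ∀ t : Double D H, Double.toEnd (L t) b = Double.toEnd t (antipodeInv D H b) := by
    refine Double.eq_of_tmul (f := fun t => Double.toEnd (L t) b) (by fun_prop) (by fun_prop)
      fun p x => ?_
    have e : L (Double.tmul p x) =
      Double.antipode D H (Double.tmul p 1) * Double.incl D H x := rfl
    rw [e, Double.toEnd_mul_incl hS, Double.antipode_tmul, antipode_one,
      Double.toEnd_incl_mul, mulAct_one hS, Double.toEnd_inclDual, Double.toEnd_tmul,
      smul_mul_assoc, _root_.one_mul]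
    rfl
  exact (hL (dualBases D H)).trans (LinearMap.congr_fun
    ((dualTensorHomEquiv D H H).apply_symm_apply LinearMap.id) _)

/-- The contraction that computes left multiplication by `b ↦ S⁻¹(b) k` in the double. -/
theorem sw_mulAct_antipodeInv_mul (k : GroupLike D H) (b : H) (G : H →ₗ[D] H) :
    sw D b (fun b₁ b₂ => mulAct (antipodeInv D H b₁ * k) b₂ G) =
      sw D b (fun c d => antipodeInv D H d * k *
        G (((k⁻¹ : GroupLike D H) : H) * antipodeInv D H (antipodeInv D H c) * k)) := by
  -- `S⁻¹` reverses the coproduct, so the last factor of `c` appears as `S⁻¹(c₃)` immediately after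
  -- `e`. Coassociativity places `c₃` just before `e` in the iterated coproduct of `b`, and the pair
  -- contracts.
  have e : ∀ c e : H, mulAct (antipodeInv D H c * k) e G =
      sw D c (fun c₁ y => sw D y (fun c₂ c₃ => antipodeInv D H c₂ * k *
        G (((k⁻¹ : GroupLike D H) : H) * antipodeInv D H (antipodeInv D H c₁) *
          (e * antipodeInv D H c₃) * k))) := by
    intro c e
    rw [mulAct, sw_mul _ _ _ (by fun_prop) (by fun_prop), sw_antipodeInv hS _ _ (by fun_prop)
      (by fun_prop), ← sw_coassoc c (fun c₁ c₂ c₃ => antipodeInv D H c₂ * k *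
        G (((k⁻¹ : GroupLike D H) : H) * antipodeInv D H (antipodeInv D H c₁) *
          (e * antipodeInv D H c₃) * k)) (by fun_prop) (by fun_prop) (by fun_prop)]
    refine sw_ext fun c' c₃ => ?_
    rw [sw_groupLike k.2 _ (by fun_prop) (by fun_prop), sw_mul _ _ _ (by fun_prop) (by fun_prop),
      sw_antipodeInv hS _ _ (by fun_prop) (by fun_prop)]
    refine sw_ext fun c₁ c₂ => ?_
    rw [sw_groupLike k.2 _ (by fun_prop) (by fun_prop), antipodeInv_mul hS,
      antipodeInv_groupLike hS]
    simp only [mul_assoc]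
  rw [sw_ext e, sw_coassoc b (fun c₁ y e => sw D y (fun c₂ c₃ => antipodeInv D H c₂ * k *
        G (((k⁻¹ : GroupLike D H) : H) * antipodeInv D H (antipodeInv D H c₁) *
          (e * antipodeInv D H c₃) * k))) (by fun_prop) (by fun_prop) (by fun_prop)]
  refine sw_ext fun c₁ y => ?_
  rw [sw_coassoc y (fun c₂ c₃ e => antipodeInv D H c₂ * k *
        G (((k⁻¹ : GroupLike D H) : H) * antipodeInv D H (antipodeInv D H c₁) *
          (e * antipodeInv D H c₃) * k)) (by fun_prop) (by fun_prop) (by fun_prop),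
    sw_contract_right (sw_mul_antipodeInv_self hS) y (fun c₂ u => antipodeInv D H c₂ * k *
        G (((k⁻¹ : GroupLike D H) : H) * antipodeInv D H (antipodeInv D H c₁) * u * k))
      (by fun_prop) (by fun_prop), _root_.mul_one]

end DoubleUnits

/-! ### The double balancing as exchange rules between `β` and conjugation by `l`. -/

section Balanced

open HopfAlgebra

variable {D H : Type*} [CommRing D] [Ring H] [HopfAlgebra D H]
  {M : Type*} [AddCommMonoid M] [Module D M] {α : H →ₐ[D] D} {g : GroupLike D H}
  {β : H →ₐ[D] D} {l : GroupLike D H}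

theorem IsDoubleBalancing.antipode_sq_eq (hbal : IsDoubleBalancing α g β l) (x : H) :
    antipode D (antipode D x) = sw D x (fun a y => sw D y (fun b c =>
      (β (antipode D a) * β c) • ((l : H) * b * ((l⁻¹ : GroupLike D H) : H)))) := by
  rw [hbal.antipode_sq, hitLeft_apply, map_sw, ← sw_coassoc x (fun a b c =>
      (β (antipode D a) * β c) • ((l : H) * b * ((l⁻¹ : GroupLike D H) : H)))
      (by fun_prop) (by fun_prop) (by fun_prop)]
  rw [(show Lin D (fun y => (l : H) * y * ((l⁻¹ : GroupLike D H) : H)) by fun_prop).map_sw]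
  refine sw_ext fun a b => ?_
  rw [map_smul, hitRight_apply, smul_sw, (show Lin D (fun y => (l : H) * y *
    ((l⁻¹ : GroupLike D H) : H)) by fun_prop).map_sw]
  refine sw_ext fun c d => ?_
  rw [mul_smul_comm, mul_smul_comm, smul_mul_assoc, smul_mul_assoc, smul_smul, mul_comm]
  rfl

/-- `∑ β⁻¹(x') l x'' l⁻¹ = ∑ β⁻¹(x'') S²(x')`. -/
theorem IsDoubleBalancing.sw_smul_conj (hbal : IsDoubleBalancing α g β l) (x : H) :
    sw D x (fun p q => β (antipode D p) • ((l : H) * q * ((l⁻¹ : GroupLike D H) : H))) =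
      sw D x (fun p q => β (antipode D q) • antipode D (antipode D p)) := by
  have e : ∀ p q : H, β (antipode D q) • antipode D (antipode D p) =
      sw D p (fun a y => sw D y (fun b c =>
      (β (antipode D a) * (β c * β (antipode D q))) •
        ((l : H) * b * ((l⁻¹ : GroupLike D H) : H)))) := by
    intro p q
    rw [hbal.antipode_sq_eq, smul_sw]
    refine sw_ext fun a y => ?_
    rw [smul_sw]
    refine sw_ext fun b c => ?_
    rw [smul_smul]
    ring_nf
  rw [sw_ext e, sw_coassoc x (fun a y q => sw D y (fun b c =>
      (β (antipode D a) * (β c * β (antipode D q))) •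
        ((l : H) * b * ((l⁻¹ : GroupLike D H) : H))))
        (by fun_prop) (by fun_prop) (by fun_prop)]
  refine sw_ext fun a y => ?_
  rw [sw_coassoc y (fun b c q => (β (antipode D a) * (β c * β (antipode D q))) •
        ((l : H) * b * ((l⁻¹ : GroupLike D H) : H)))
        (by fun_prop) (by fun_prop) (by fun_prop)]
  simp only [mul_smul (β (antipode D a))]
  have e₂ := sw_algHom_smul_antipode_right β y
    (fun b => β (antipode D a) • ((l : H) * b * ((l⁻¹ : GroupLike D H) : H))) (by fun_prop)
  rw [← e₂]
  refine sw_ext fun b z => sw_ext fun c d => ?_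
  rw [smul_comm]

/-- `∑ β⁻¹(x') l S⁻²(x'') l⁻¹ = ∑ β⁻¹(x'') x'`. -/
theorem IsDoubleBalancing.sw_smul_conj_antipodeInv (hbal : IsDoubleBalancing α g β l)
    (hS : IsUnit (antipode D : Module.End D H)) (x : H) (f : H → M) (hf : Lin D f) :
    sw D x (fun p q => β (antipode D p) • f ((l : H) *
      antipodeInv D H (antipodeInv D H q) * ((l⁻¹ : GroupLike D H) : H))) =
      sw D x (fun p q => β (antipode D q) • f p) := by
  have e := congrArg (fun y => f (antipodeInv D H (antipodeInv D H y))) (hbal.sw_smul_conj x)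
  simp only [map_sw, map_smul, hf.map_sw, hf.2, antipodeInv_antipode hS, antipodeInv_mul hS,
    antipodeInv_groupLike hS] at e
  simpa only [inv_inv, ← GroupLike.val_inv, mul_assoc] using e

/-- `∑ β(x') l⁻¹ x'' l = ∑ β(x'') S⁻²(x')`. -/
theorem IsDoubleBalancing.sw_smul_conj_inv (hbal : IsDoubleBalancing α g β l)
    (hS : IsUnit (antipode D : Module.End D H)) (x : H) (f : H → M) (hf : Lin D f) :
    sw D x (fun p q => β p • f (((l⁻¹ : GroupLike D H) : H) * q * l)) =
      sw D x (fun p q => β q • f (antipodeInv D H (antipodeInv D H p))) := by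
  -- Inserting `β * β⁻¹ = ε` in front of `p` produces the `β⁻¹`-weighted sum of the previous rule;
  -- the remaining `β⁻¹` and `β(q)` then cancel.
  have e : ∀ p q : H, β q • f (antipodeInv D H (antipodeInv D H p)) =
      sw D p (fun a y => sw D y (fun b c => β a • ((β (antipode D c) * β q) •
        f (((l⁻¹ : GroupLike D H) : H) * b * l)))) := by
    intro p q
    rw [← sw_algHom_smul_antipode_left β p (fun p => f (antipodeInv D H (antipodeInv D H p)))
      (by fun_prop), smul_sw]
    refine sw_ext fun a y => ?_
    have e' := hbal.sw_smul_conj_antipodeInv hS y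
      (fun b => f (((l⁻¹ : GroupLike D H) : H) * b * l)) (by fun_prop)
    simp only [← mul_assoc, groupLike_inv_mul, one_mul] at e'
    simp only [mul_assoc, groupLike_inv_mul, mul_one] at e'
    simp only [mul_smul, smul_comm _ (β q)]
    rw [← smul_sw, ← smul_sw, e']
    simp only [mul_assoc, smul_sw]
  rw [sw_ext e, sw_coassoc x (fun a y q => sw D y (fun b c => β a • ((β (antipode D c) * β q) •
        f (((l⁻¹ : GroupLike D H) : H) * b * l)))) (by fun_prop) (by fun_prop) (by fun_prop)]
  refine sw_ext fun a y => ?_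
  rw [sw_coassoc y (fun b c q => β a • ((β (antipode D c) * β q) •
        f (((l⁻¹ : GroupLike D H) : H) * b * l))) (by fun_prop) (by fun_prop) (by fun_prop)]
  rw [← sw_algHom_antipode_smul_right β y (fun b => f (((l⁻¹ : GroupLike D H) : H) * b * l))
    (by fun_prop), smul_sw]
  refine sw_ext fun b z => ?_
  rw [smul_sw]

end Balanced

/-! ### The ribbon element and its inverse as endomorphisms. -/

section Ribbon

open HopfAlgebra

variable {D H : Type*} [CommRing D] [Ring H] [HopfAlgebra D H]
  [Module.Finite D H] [Module.Projective D H] {α : H →ₐ[D] D} {g : GroupLike D H}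
  {β : H →ₐ[D] D} {l : GroupLike D H}

/-- The endomorphism attached to the ribbon element is `b ↦ ∑ β⁻¹(b') S⁻¹(b'') l⁻¹`. -/
theorem toEnd_ribbon (hS : IsUnit (antipode D : Module.End D H)) (b : H) :
    Double.toEnd (Double.ribbon β l) b = sw D b (fun p q =>
      β (antipode D p) • (antipodeInv D H q * ((l⁻¹ : GroupLike D H) : H))) := by
  rw [Double.ribbon, Double.toEnd_mul]
  have e := sw_mulAct_antipodeInv_mul hS 1 b
    ((formInv β).smulRight ((l⁻¹ : GroupLike D H) : H))
  simp only [inv_one, GroupLike.val_one, mul_one, one_mul] at e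
  simp only [Double.toEnd_drinfeldElem hS]
  refine e.trans (sw_ext fun c d => ?_)
  rw [LinearMap.smulRight_apply, mul_smul_comm, formInv, LinearMap.comp_apply,
    antipode_antipodeInv hS]
  congr 1
  -- `β ∘ S⁻¹ = β ∘ S`, since `β ∘ S² = β`.
  change β (antipodeInv D H c) = _
  rw [← algHom_antipode_antipode, antipode_antipodeInv hS]

/-- Left multiplication by the ribbon element. -/
theorem toEnd_ribbon_mul (hbal : IsDoubleBalancing α g β l)
    (hS : IsUnit (antipode D : Module.End D H)) (c : Double D H) (b : H) :
    Double.toEnd (Double.ribbon β l * c) b = sw D b (fun b₁ y => sw D y (fun b₂ b₃ =>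
      β (antipode D b₂) • (antipodeInv D H b₃ * ((l⁻¹ : GroupLike D H) : H) *
        Double.toEnd c b₁))) := by
  set G := Double.toEnd c
  have e : ∀ b₁ b₂ : H, mulAct (Double.toEnd (Double.ribbon β l) b₁) b₂ G =
      sw D b₁ (fun p q => β (antipode D p) •
        mulAct (antipodeInv D H q * ((l⁻¹ : GroupLike D H) : H)) b₂ G) := by
    intro b₁ b₂
    rw [toEnd_ribbon hS, (show Lin D (fun z => mulAct z b₂ G) by fun_prop).map_sw]
    refine sw_ext fun p q => ?_
    rw [(show Lin D (fun z => mulAct z b₂ G) by fun_prop).2]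
  rw [Double.toEnd_mul, sw_ext e, sw_coassoc b (fun p q b₂ => β (antipode D p) •
        mulAct (antipodeInv D H q * ((l⁻¹ : GroupLike D H) : H)) b₂ G)
        (by fun_prop) (by fun_prop) (by fun_prop)]
  have e₂ : ∀ p y : H, sw D y (fun q b₂ => β (antipode D p) •
      mulAct (antipodeInv D H q * ((l⁻¹ : GroupLike D H) : H)) b₂ G) =
      sw D y (fun c d => β (antipode D p) • (antipodeInv D H d * ((l⁻¹ : GroupLike D H) : H) *
        G ((l : H) * antipodeInv D H (antipodeInv D H c) * ((l⁻¹ : GroupLike D H) : H)))) := by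
    intro p y
    rw [← smul_sw, sw_mulAct_antipodeInv_mul hS l⁻¹ y G, smul_sw, inv_inv]
  rw [sw_ext e₂, ← sw_coassoc b (fun p c d => β (antipode D p) •
        (antipodeInv D H d * ((l⁻¹ : GroupLike D H) : H) *
        G ((l : H) * antipodeInv D H (antipodeInv D H c) * ((l⁻¹ : GroupLike D H) : H))))
        (by fun_prop) (by fun_prop) (by fun_prop),
    ← sw_coassoc b (fun b₁ b₂ b₃ => β (antipode D b₂) •
      (antipodeInv D H b₃ * ((l⁻¹ : GroupLike D H) : H) * G b₁))
        (by fun_prop) (by fun_prop) (by fun_prop)]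
  refine sw_ext fun a d => ?_
  -- The balancing enters here: it removes `S⁻²` and the conjugation by `l` from the argument of
  -- `G`.
  exact hbal.sw_smul_conj_antipodeInv hS a
    (fun z => antipodeInv D H d * ((l⁻¹ : GroupLike D H) : H) * G z) (by fun_prop)

/-- The inverse of the ribbon element, attached to the endomorphism `b ↦ ∑ β(b'') l b'`. -/
def ribbonInv (β : H →ₐ[D] D) (l : GroupLike D H) : Double D H :=
  Double.ofEnd (show Lin D (fun b : H => sw D b (fun p q => β q • ((l : H) * p)))
    by fun_prop).toLinearMap

theorem toEnd_ribbonInv (b : H) :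
    Double.toEnd (ribbonInv β l) b = sw D b (fun p q => β q • ((l : H) * p)) := by
  rw [ribbonInv, Double.toEnd_ofEnd]
  rfl

/-- Left multiplication by the inverse of the ribbon element. -/
theorem toEnd_ribbonInv_mul (hbal : IsDoubleBalancing α g β l)
    (hS : IsUnit (antipode D : Module.End D H)) (c : Double D H) (b : H) :
    Double.toEnd (ribbonInv β l * c) b = sw D b (fun b₁ y => sw D y (fun b₂ b₃ =>
      β b₃ • ((l : H) * b₂ * Double.toEnd c b₁))) := by
  set G := Double.toEnd c
  have e : ∀ b₁ b₂ : H, mulAct (Double.toEnd (ribbonInv β l) b₁) b₂ G =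
      sw D b₁ (fun c q => sw D c (fun c₁ z => sw D z (fun c₂ c₃ => β q • ((l : H) * c₂ *
        G (antipodeInv D H c₃ * (((l⁻¹ : GroupLike D H) : H) * b₂ * l) * c₁))))) := by
    intro b₁ b₂
    rw [toEnd_ribbonInv, (show Lin D (fun z => mulAct z b₂ G) by fun_prop).map_sw]
    refine sw_ext fun c q => ?_
    rw [(show Lin D (fun z => mulAct z b₂ G) by fun_prop).2, mulAct,
      sw_mul _ _ _ (by fun_prop) (by fun_prop), sw_groupLike l.2 _ (by fun_prop) (by fun_prop),
      smul_sw]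
    refine sw_ext fun c₁ z => ?_
    rw [sw_mul _ _ _ (by fun_prop) (by fun_prop), sw_groupLike l.2 _ (by fun_prop) (by fun_prop),
      smul_sw]
    refine sw_ext fun c₂ c₃ => ?_
    rw [antipodeInv_mul hS, antipodeInv_groupLike hS]
    simp only [mul_assoc]
  rw [Double.toEnd_mul, sw_ext e, sw_coassoc b (fun c q b₂ => sw D c (fun c₁ z => sw D z
    (fun c₂ c₃ => β q • ((l : H) * c₂ *
        G (antipodeInv D H c₃ * (((l⁻¹ : GroupLike D H) : H) * b₂ * l) * c₁)))))
        (by fun_prop) (by fun_prop) (by fun_prop)]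
  have e₂ : ∀ c y : H, sw D y (fun q b₂ => sw D c (fun c₁ z => sw D z
      (fun c₂ c₃ => β q • ((l : H) * c₂ *
        G (antipodeInv D H c₃ * (((l⁻¹ : GroupLike D H) : H) * b₂ * l) * c₁))))) =
      sw D y (fun p q => sw D c (fun c₁ z => sw D z
      (fun c₂ c₃ => β q • ((l : H) * c₂ *
        G (antipodeInv D H (antipodeInv D H p * c₃) * c₁))))) := by
    intro c y
    -- The balancing trades `l⁻¹b₂l` for `S⁻²(p)`, which merges with `S⁻¹(c₃)` into `S⁻¹(S⁻¹(p)c₃)`;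
    -- this contracts once `c₃` and `p` are adjacent.
    have e₃ := hbal.sw_smul_conj_inv hS y (fun w => sw D c (fun c₁ z => sw D z
      (fun c₂ c₃ => (l : H) * c₂ * G (antipodeInv D H c₃ * w * c₁)))) (by fun_prop)
    simpa only [smul_sw, antipodeInv_mul hS] using e₃
  have e₃ : ∀ c y : H, sw D y (fun p q => sw D c (fun c₁ z => sw D z (fun c₂ c₃ => β q •
      ((l : H) * c₂ * G (antipodeInv D H (antipodeInv D H p * c₃) * c₁))))) =
      sw D c (fun c₁ z => sw D z (fun c₂ c₃ => sw D y (fun p q => β q •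
      ((l : H) * c₂ * G (antipodeInv D H (antipodeInv D H p * c₃) * c₁))))) := by
    intro c y
    rw [sw_comm]
    exact sw_ext fun c₁ z => sw_comm _ _ _
  rw [sw_ext e₂, sw_ext e₃, sw_coassoc b (fun c₁ z y => sw D z (fun c₂ c₃ =>
    sw D y (fun p q => β q •
      ((l : H) * c₂ * G (antipodeInv D H (antipodeInv D H p * c₃) * c₁)))))
        (by fun_prop) (by fun_prop) (by fun_prop)]
  refine sw_ext fun c₁ w => ?_
  rw [sw_coassoc w (fun c₂ c₃ y => sw D y (fun p q => β q •
      ((l : H) * c₂ * G (antipodeInv D H (antipodeInv D H p * c₃) * c₁))))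
        (by fun_prop) (by fun_prop) (by fun_prop)]
  refine sw_ext fun c₂ v => ?_
  rw [sw_contract_left (sw_antipodeInv_mul_self hS) (by fun_prop) (by fun_prop) v
    (fun u q => β q • ((l : H) * c₂ * G (antipodeInv D H u * c₁))) (by fun_prop) (by fun_prop),
    antipodeInv_one hS, one_mul]

/-- Substituting one multiplication formula in the other gives `∑ β⁻¹(b'')β(b⁗') l b⁗ S⁻¹(b''') l⁻¹
c(b')`, where the `S⁻¹` pair, then `l`, then `β` cancel. The arbitrary factor `c` makes
associativity of the double unnecessary. -/
theorem ribbonInv_mul_ribbon_mul (hbal : IsDoubleBalancing α g β l)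
    (hS : IsUnit (antipode D : Module.End D H)) (c : Double D H) :
    ribbonInv β l * (Double.ribbon β l * c) = c := by
  refine Double.ext_toEnd fun b => ?_
  set G := Double.toEnd c with hG
  rw [toEnd_ribbonInv_mul hbal hS]
  have e : ∀ b₁ b₂ b₃ : H, β b₃ • ((l : H) * b₂ *
      Double.toEnd (Double.ribbon β l * c) b₁) = sw D b₁ (fun c₁ y => sw D y (fun c₂ c₃ =>
        (β (antipode D c₂) * β b₃) • ((l : H) * (b₂ * antipodeInv D H c₃) *
          ((l⁻¹ : GroupLike D H) : H) * G c₁))) := by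
    intro b₁ b₂ b₃
    rw [toEnd_ribbon_mul hbal hS, (show Lin D (fun z => β b₃ • ((l : H) * b₂ * z))
      by fun_prop).map_sw]
    refine sw_ext fun c₁ y => ?_
    rw [(show Lin D (fun z => β b₃ • ((l : H) * b₂ * z)) by fun_prop).map_sw]
    refine sw_ext fun c₂ c₃ => ?_
    rw [mul_smul_comm, smul_smul, mul_comm (β b₃)]
    simp only [mul_assoc]
    rfl
  rw [sw_ext fun b₁ y => sw_ext fun b₂ b₃ => e b₁ b₂ b₃]
  rw [← sw_coassoc b (fun b₁ b₂ b₃ => sw D b₁ (fun c₁ y => sw D y (fun c₂ c₃ =>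
        (β (antipode D c₂) * β b₃) • ((l : H) * (b₂ * antipodeInv D H c₃) *
          ((l⁻¹ : GroupLike D H) : H) * G c₁))))
        (by fun_prop) (by fun_prop) (by fun_prop)]
  have e₂ : ∀ a b₃ : H, sw D a (fun b₁ b₂ => sw D b₁ (fun c₁ y => sw D y (fun c₂ c₃ =>
        (β (antipode D c₂) * β b₃) • ((l : H) * (b₂ * antipodeInv D H c₃) *
          ((l⁻¹ : GroupLike D H) : H) * G c₁)))) =
        sw D a (fun c₁ c₂ => (β (antipode D c₂) * β b₃) • G c₁) := by
    intro a b₃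
    rw [sw_coassoc a (fun c₁ y b₂ => sw D y (fun c₂ c₃ =>
        (β (antipode D c₂) * β b₃) • ((l : H) * (b₂ * antipodeInv D H c₃) *
          ((l⁻¹ : GroupLike D H) : H) * G c₁)))
        (by fun_prop) (by fun_prop) (by fun_prop)]
    refine sw_ext fun c₁ y => ?_
    rw [sw_coassoc y (fun c₂ c₃ b₂ =>
        (β (antipode D c₂) * β b₃) • ((l : H) * (b₂ * antipodeInv D H c₃) *
          ((l⁻¹ : GroupLike D H) : H) * G c₁))
        (by fun_prop) (by fun_prop) (by fun_prop),
      sw_contract_right (sw_mul_antipodeInv_self hS) y (fun c₂ u =>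
        (β (antipode D c₂) * β b₃) • ((l : H) * u *
          ((l⁻¹ : GroupLike D H) : H) * G c₁)) (by fun_prop) (by fun_prop), mul_one,
      groupLike_mul_inv, one_mul]
  rw [sw_ext e₂, sw_coassoc b (fun c₁ c₂ b₃ => (β (antipode D c₂) * β b₃) • G c₁)
        (by fun_prop) (by fun_prop) (by fun_prop)]
  exact sw_algHom_antipode_smul_right β b (fun x => G x) (by fun_prop)

theorem ribbon_mul_ribbonInv_mul (hbal : IsDoubleBalancing α g β l)
    (hS : IsUnit (antipode D : Module.End D H)) (c : Double D H) :
    Double.ribbon β l * (ribbonInv β l * c) = c := by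
  refine Double.ext_toEnd fun b => ?_
  set G := Double.toEnd c with hG
  rw [toEnd_ribbon_mul hbal hS]
  have e : ∀ b₁ b₂ b₃ : H, β (antipode D b₂) • (antipodeInv D H b₃ *
      ((l⁻¹ : GroupLike D H) : H) * Double.toEnd (ribbonInv β l * c) b₁) =
      sw D b₁ (fun c₁ y => sw D y (fun c₂ c₃ =>
        (β c₃ * β (antipode D b₂)) • (antipodeInv D H b₃ * c₂ * G c₁))) := by
    intro b₁ b₂ b₃
    rw [toEnd_ribbonInv_mul hbal hS, (show Lin D (fun z => β (antipode D b₂) •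
      (antipodeInv D H b₃ * ((l⁻¹ : GroupLike D H) : H) * z)) by fun_prop).map_sw]
    refine sw_ext fun c₁ y => ?_
    rw [(show Lin D (fun z => β (antipode D b₂) •
      (antipodeInv D H b₃ * ((l⁻¹ : GroupLike D H) : H) * z)) by fun_prop).map_sw]
    refine sw_ext fun c₂ c₃ => ?_
    rw [mul_smul_comm, smul_smul, mul_comm (β c₃), ← mul_assoc, ← mul_assoc,
      mul_assoc (antipodeInv D H b₃), groupLike_inv_mul, mul_one]
  rw [sw_ext fun b₁ y => sw_ext fun b₂ b₃ => e b₁ b₂ b₃]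
  rw [← sw_coassoc b (fun b₁ b₂ b₃ => sw D b₁ (fun c₁ y => sw D y (fun c₂ c₃ =>
        (β c₃ * β (antipode D b₂)) • (antipodeInv D H b₃ * c₂ * G c₁))))
        (by fun_prop) (by fun_prop) (by fun_prop)]
  have e₂ : ∀ a b₃ : H, sw D a (fun b₁ b₂ => sw D b₁ (fun c₁ y => sw D y (fun c₂ c₃ =>
        (β c₃ * β (antipode D b₂)) • (antipodeInv D H b₃ * c₂ * G c₁)))) =
        sw D a (fun c₁ c₂ => antipodeInv D H b₃ * c₂ * G c₁) := by
    intro a b₃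
    rw [sw_coassoc a (fun c₁ y b₂ => sw D y (fun c₂ c₃ =>
        (β c₃ * β (antipode D b₂)) • (antipodeInv D H b₃ * c₂ * G c₁)))
        (by fun_prop) (by fun_prop) (by fun_prop)]
    refine sw_ext fun c₁ y => ?_
    rw [sw_coassoc y (fun c₂ c₃ b₂ =>
        (β c₃ * β (antipode D b₂)) • (antipodeInv D H b₃ * c₂ * G c₁))
        (by fun_prop) (by fun_prop) (by fun_prop)]
    exact sw_algHom_smul_antipode_right β y (fun c₂ => antipodeInv D H b₃ * c₂ * G c₁)
      (by fun_prop)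
  rw [sw_ext e₂, sw_coassoc b (fun c₁ c₂ b₃ => antipodeInv D H b₃ * c₂ * G c₁)
        (by fun_prop) (by fun_prop) (by fun_prop),
    sw_contract_right (sw_antipodeInv_mul_self hS) b (fun c₁ u => u * G c₁)
      (by fun_prop) (by fun_prop), one_mul]

theorem ribbon_mul_ribbonInv (hbal : IsDoubleBalancing α g β l)
    (hS : IsUnit (antipode D : Module.End D H)) :
    Double.ribbon β l * ribbonInv β l = 1 := by
  have e := ribbon_mul_ribbonInv_mul hbal hS 1
  rwa [Double.mul_one hS] at e

theorem ribbonInv_mul_ribbon (hbal : IsDoubleBalancing α g β l)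
    (hS : IsUnit (antipode D : Module.End D H)) :
    ribbonInv β l * Double.ribbon β l = 1 := by
  have e := ribbonInv_mul_ribbon_mul hbal hS 1
  rwa [Double.mul_one hS] at e

/-- Cancelling `r` from the left in `r s = 1` shows that the value of `λ_D` on an inverse does not
depend on the inverse. -/
theorem eq_ribbonInv (hbal : IsDoubleBalancing α g β l)
    (hS : IsUnit (antipode D : Module.End D H)) {s : Double D H}
    (hs : Double.ribbon β l * s = 1) : s = ribbonInv β l := by
  rw [← ribbonInv_mul_ribbon_mul hbal hS s, hs, Double.mul_one hS]

end Ribbon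

/-! ### Values of the integral on the cointegral, the ribbon element and its inverse. -/

section Values

open HopfAlgebra

variable {D H : Type*} [CommRing D] [Ring H] [HopfAlgebra D H]
  {Lam : H} {lam : Dual D H} {α : H →ₐ[D] D} {g : GroupLike D H}
  {β : H →ₐ[D] D} {l : GroupLike D H}

theorem integral_apply (a : Double D H) :
    Double.integral β l Lam lam a =
      ((theta β l ^ (-2 : ℤ) : Dˣ) : D) * lam (Double.toEnd a Lam) := by
  refine Double.eq_of_tmul (f := fun a => Double.integral β l Lam lam a)
    (g := fun a => ((theta β l ^ (-2 : ℤ) : Dˣ) : D) * lam (Double.toEnd a Lam))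
    (by fun_prop) (by fun_prop) (fun p x => ?_) a
  rw [Double.toEnd_tmul, map_smul]
  rfl

theorem coe_theta : ((theta β l : Dˣ) : D) = β l := rfl

theorem coe_theta_inv : (((theta β l)⁻¹ : Dˣ) : D) = β (antipode D (l : H)) := rfl

theorem IsDoubleBalancing.apply_modulus (hbal : IsDoubleBalancing α g β l) :
    β g = ((theta β l ^ 2 : Dˣ) : D) := by
  rw [← hbal.sq_elem, GroupLike.val_mul, map_mul, Units.val_pow_eq_pow_val, coe_theta, sq]

theorem IsDoubleBalancing.modulus_apply_modulus (hbal : IsDoubleBalancing α g β l) :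
    α g = ((theta β l ^ 4 : Dˣ) : D) := by
  have e := LinearMap.congr_fun hbal.sq_form (g : H)
  rw [dualMul_tmul_apply, sw_groupLike g.2 _ (by fun_prop) (by fun_prop)] at e
  change β g * β g = α g at e
  rw [← e, hbal.apply_modulus, ← Units.val_mul]
  congr 1
  group

theorem toEnd_cointegral (b : H) :
    Double.toEnd (Double.cointegral β l Lam lam) b =
      (((theta β l ^ (2 : ℤ) : Dˣ) : D) * lam (antipode D b)) • antipode D Lam := by
  rw [Double.cointegral, map_smul, LinearMap.smul_apply, Double.toEnd_tmul, smul_smul]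
  rfl

theorem toEnd_cointegral_eq :
    Double.toEnd (Double.cointegral β l Lam lam) =
      (((theta β l ^ (2 : ℤ) : Dˣ) : D) • (lam ∘ₗ antipode D)).smulRight (antipode D Lam) :=
  LinearMap.ext fun b => toEnd_cointegral b

theorem integral_cointegral (h : IsIntegralPair Lam lam α g) :
    Double.integral β l Lam lam (Double.cointegral β l Lam lam) = 1 := by
  rw [integral_apply, toEnd_cointegral, h.apply_antipode, map_smul, h.apply_antipode, mul_one,
    smul_eq_mul, mul_one, ← Units.val_mul, ← Units.val_one]
  congr 1
  group

theorem algHom_groupLike_mul_antipode (φ : H →ₐ[D] D) (g : GroupLike D H) :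
    φ g * φ (antipode D (g : H)) = 1 := by
  rw [← map_mul, ← GroupLike.val_inv, groupLike_mul_inv, map_one]

variable [Module.Finite D H] [Module.Projective D H]

/-- The dual bases formula gives `∑ λ(lΛ')β(Λ'') = β(S⁻¹(l)) = θ⁻¹`; the normalization of `λ_D`
contributes `θ⁻²`. -/
theorem integral_ribbonInv (h : IsIntegralPair Lam lam α g) :
    Double.integral β l Lam lam (ribbonInv β l) = ((theta β l ^ (-3 : ℤ) : Dˣ) : D) := by
  rw [integral_apply, toEnd_ribbonInv, map_sw]
  simp only [map_smul, smul_eq_mul, mul_comm (β _)]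
  have e := h.sw_mul_smul (l : H) (fun b => β b) (by fun_prop)
  simp only [smul_eq_mul] at e
  rw [e, antipodeInv_groupLike h.isUnit_antipode, GroupLike.val_inv, ← coe_theta_inv,
    ← Units.val_mul]
  congr 1
  group

/-- Since `λ(S⁻¹(y)) = λ(yg)`, the value is `θ⁻² ∑ β⁻¹(Λ')λ(lΛ''g)`. Shifting `l` across `Δ(Λ)`
gives a factor `β(l)`, the modulus property at `Λg` gives `α(g)`, and `θ⁻² · θ · θ⁴ = θ³`. -/
theorem integral_ribbon (h : IsIntegralPair Lam lam α g) (hbal : IsDoubleBalancing α g β l) :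
    Double.integral β l Lam lam (Double.ribbon β l) = ((theta β l ^ (3 : ℤ) : Dˣ) : D) := by
  have hS := h.isUnit_antipode
  rw [integral_apply, toEnd_ribbon hS, map_sw]
  have e₁ : ∀ a b : H, lam (β (antipode D a) •
      (antipodeInv D H b * ((l⁻¹ : GroupLike D H) : H))) =
      β (antipode D a) * lam ((l : H) * b * g) := by
    intro a b
    rw [map_smul, smul_eq_mul, ← antipodeInv_groupLike hS, ← antipodeInv_mul hS,
      h.apply_antipodeInv]
  have e₂ := h.left.sw_mul_right (l : H) (fun a b => β (antipode D a) * lam (b * g))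
    (by fun_prop) (by fun_prop)
  -- The factor `β(g)β⁻¹(g) = 1` is inserted so that both slots carry `g` and form the coproduct of
  -- `Λg`.
  have e₃ : ∀ a b : H, β (antipode D (antipode D (l : H) * a)) * lam (b * g) =
      (β l * β g) * (lam (b * g) • β (antipode D (a * g))) := by
    intro a b
    rw [antipode_mul_antidistrib, l.2.antipode_antipode, antipode_mul_antidistrib, map_mul β,
      map_mul β, smul_eq_mul]
    linear_combination (- β (antipode D a) * β l * lam (b * g)) *
      algHom_groupLike_mul_antipode β g
  have e₄ : sw D Lam (fun a b => lam (b * g) • β (antipode D (a * g))) =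
      α g * β (antipode D (g : H)) := by
    have e := h.sw_right_apply (Lam * g) (fun a => β (antipode D a)) (by fun_prop)
    rw [sw_mul _ _ _ (by fun_prop) (by fun_prop), h.mul, map_smul, h.apply_self,
      smul_eq_mul, smul_eq_mul, mul_one] at e
    rw [← e]
    refine sw_ext fun a b => ?_
    rw [sw_groupLike g.2 _ (by fun_prop) (by fun_prop)]
  rw [sw_ext e₁, e₂, sw_ext e₃, ← (show Lin D (fun z : D => β l * β g * z) by fun_prop).map_sw,
    e₄]
  calc _ = ((theta β l ^ (-2 : ℤ) : Dˣ) : D) * (β l * α g) *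
      (β g * β (antipode D (g : H))) := by ring
    _ = _ := by
      rw [algHom_groupLike_mul_antipode, mul_one, hbal.modulus_apply_modulus, ← coe_theta,
        ← Units.val_mul, ← Units.val_mul]
      congr 1
      group

end Values

/-! ### Translated integrals and the left integral `λ ∘ S`. -/

section LeftIntegral

open HopfAlgebra

variable {D H : Type*} [CommRing D] [Ring H] [HopfAlgebra D H]
  {M : Type*} [AddCommMonoid M] [Module D M]
  {Lam : H} {lam : Dual D H} {α : H →ₐ[D] D} {g : GroupLike D H}
  (h : IsIntegralPair Lam lam α g)

include h

theorem IsIntegralPair.sw_mul_groupLike_apply (x : H) (f : H → M) (hf : Lin D f) :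
    sw D x (fun a b => lam (a * g) • f b) =
      lam (x * g) • f ((g⁻¹ : GroupLike D H) : H) := by
  have e := h.sw_left_apply (x * g) (fun y => f (y * ((g⁻¹ : GroupLike D H) : H))) (by fun_prop)
  rw [sw_mul _ _ _ (by fun_prop) (by fun_prop), one_mul] at e
  rw [← e]
  refine sw_ext fun a b => ?_
  rw [sw_groupLike g.2 _ (by fun_prop) (by fun_prop), mul_assoc b, groupLike_mul_inv, mul_one]

variable [Module.Finite D H]

/-- `λ ∘ S` is a left integral. -/
theorem IsIntegralPair.sw_antipode_right_apply (x : H) (f : H → M) (hf : Lin D f) :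
    sw D x (fun a b => lam (antipode D b) • f a) = lam (antipode D x) • f 1 := by
  have e := h.sw_left_apply (antipode D x) (fun y => f (antipodeInv D H y)) (by fun_prop)
  rw [sw_antipode _ _ (by fun_prop) (by fun_prop)] at e
  simpa only [antipodeInv_antipode h.isUnit_antipode, antipodeInv_one h.isUnit_antipode] using e

theorem IsIntegralPair.sw_antipode_left_apply (x : H) (f : H → M) (hf : Lin D f) :
    sw D x (fun a b => lam (antipode D a) • f b) =
      lam (antipode D x) • f ((g⁻¹ : GroupLike D H) : H) := by
  have e := h.sw_right_apply (antipode D x) (fun y => f (antipodeInv D H y)) (by fun_prop)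
  rw [sw_antipode _ _ (by fun_prop) (by fun_prop)] at e
  simpa only [antipodeInv_antipode h.isUnit_antipode,
    antipodeInv_groupLike h.isUnit_antipode] using e

end LeftIntegral

/-! ### Cointegrals of the double. -/

section Cointegral

open HopfAlgebra

variable {D H : Type*} [CommRing D] [Ring H] [HopfAlgebra D H] [Module.Finite D H]
  {Lam : H} {lam : Dual D H} {α : H →ₐ[D] D} {g : GroupLike D H}
  {β : H →ₐ[D] D} {l : GroupLike D H} (h : IsIntegralPair Lam lam α g)

theorem mem_span_of_toEnd [Module.Projective D H] {c : Double D H} (t : D)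
    (hc : ∀ b, Double.toEnd c b = (t * lam (antipode D b)) • antipode D Lam) :
    c ∈ Submodule.span D {Double.cointegral β l Lam lam} := by
  rw [Submodule.mem_span_singleton]
  refine ⟨t * ((theta β l ^ (-2 : ℤ) : Dˣ) : D), Double.ext_toEnd fun b => ?_⟩
  have e : ((theta β l ^ (-2 : ℤ) : Dˣ) : D) * ((theta β l ^ (2 : ℤ) : Dˣ) : D) = 1 := by
    rw [← Units.val_mul, ← Units.val_one]
    congr 1
    group
  rw [map_smul, LinearMap.smul_apply, toEnd_cointegral, hc, smul_smul]
  congr 1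
  linear_combination (t * lam (antipode D b)) * e

include h

/-- `Y''S(Λ)` gives the weight `α⁻¹(Y'')`, which is what the Nakayama formula needs to carry `Y'''`
in `λ(S(Y')S(b)Y''')` to the front as `S²`. Then `Y'S(Y'')` contracts. -/
theorem mulAct_left_integral (Y b : H) :
    mulAct Y b ((lam ∘ₗ antipode D).smulRight (antipode D Lam)) =
      (counit (R := D) Y * lam (antipode D b)) • antipode D Lam := by
  have hS := h.isUnit_antipode
  rw [mulAct_smul_const]
  have e : ∀ Y₁ Z : H, sw D Z (fun Y₂ Y₃ => (lam ∘ₗ antipode D) (antipodeInv D H Y₃ * b * Y₁) •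
      (Y₂ * antipode D Lam)) = lam (antipode D (Y₁ * antipode D Z) * antipode D b) •
        antipode D Lam := by
    intro Y₁ Z
    rw [antipode_mul_antidistrib, mul_assoc, h.apply_antipode_antipode_mul, sw_smul]
    refine sw_ext fun p q => ?_
    rw [h.mul_antipode, smul_smul, LinearMap.comp_apply, antipode_mul_antidistrib,
      antipode_mul_antidistrib, antipode_antipodeInv hS, mul_comm, mul_assoc]
  rw [sw_ext e, ← (show Lin D (fun z => lam (antipode D z * antipode D b) • antipode D Lam)
    by fun_prop).map_sw, sw_mul_antipode_self, map_smul, antipode_one, smul_mul_assoc, one_mul,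
    map_smul, smul_eq_mul]

/-- With `X = S(Λ)`, the exchange rule for `Δ(X)` changes `S⁻¹(X''')g⁻¹X'` into `S(X')X''`, leaving
`X G(1)`. The base point `g⁻¹` comes from `∑ λ(S(b'))b'' = λ(S(b))g⁻¹`. -/
theorem mulAct_antipode_groupLike (G : H →ₗ[D] H) :
    mulAct (antipode D Lam) ((g⁻¹ : GroupLike D H) : H) G =
      counit (R := D) (G 1) • antipode D Lam := by
  have hS := h.isUnit_antipode
  rw [mulAct, ← sw_coassoc (antipode D Lam) (fun X₁ X₂ X₃ =>
    X₂ * G (antipodeInv D H X₃ * ((g⁻¹ : GroupLike D H) : H) * X₁))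
    (by fun_prop) (by fun_prop) (by fun_prop),
    h.sw_antipode_swap (fun b a => sw D a (fun X₁ X₂ =>
      X₂ * G (antipodeInv D H b * ((g⁻¹ : GroupLike D H) : H) * X₁)))
      (by fun_prop) (by fun_prop)]
  simp only [antipodeInv_mul hS, antipodeInv_antipode hS, antipodeInv_groupLike hS, inv_inv]
  simp only [mul_assoc, groupLike_mul_inv, one_mul]
  rw [sw_contract_left (sw_antipode_mul_self (D := D)) (by fun_prop) (by fun_prop)
    (antipode D Lam) (fun u d => d * G u) (by fun_prop) (by fun_prop),
    h.isRightCointegral_antipode h.left]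

variable [Module.Projective D H]

theorem isLeftCointegral_cointegral :
    IsLeftCointegral D (Double.cointegral β l Lam lam) := by
  intro d
  have e₁ : ∀ G : H →ₗ[D] H, ∀ c : D, ∀ X b, mulAct X b (c • G) = c • mulAct X b G := by
    intro G c X b
    exact (show Lin D (fun G : H →ₗ[D] H => mulAct X b G) by fun_prop).2 c G
  refine Double.ext_toEnd fun b => ?_
  rw [map_smul, LinearMap.smul_apply, toEnd_cointegral, Double.toEnd_mul, Double.counit_eq]
  have e₂ : ∀ b₁ b₂ : H, mulAct (Double.toEnd d b₁) b₂
      (Double.toEnd (Double.cointegral β l Lam lam)) = lam (antipode D b₂) •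
        ((((theta β l ^ (2 : ℤ) : Dˣ) : D) * counit (R := D) (Double.toEnd d b₁)) •
          antipode D Lam) := by
    intro b₁ b₂
    rw [toEnd_cointegral_eq, show ((((theta β l ^ (2 : ℤ) : Dˣ) : D) •
      (lam ∘ₗ antipode D)).smulRight (antipode D Lam) : H →ₗ[D] H) =
      ((theta β l ^ (2 : ℤ) : Dˣ) : D) • (lam ∘ₗ antipode D).smulRight (antipode D Lam) by
        ext; simp [mul_smul], e₁, mulAct_left_integral h, smul_smul, smul_smul]
    ring_nf
  rw [sw_ext e₂, h.sw_antipode_right_apply b (fun b₁ => (((theta β l ^ (2 : ℤ) : Dˣ) : D) *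
    counit (R := D) (Double.toEnd d b₁)) • antipode D Lam) (by fun_prop), smul_smul, smul_smul]
  ring_nf

theorem isRightCointegral_cointegral :
    IsRightCointegral D (Double.cointegral β l Lam lam) := by
  intro d
  refine Double.ext_toEnd fun b => ?_
  rw [map_smul, LinearMap.smul_apply, toEnd_cointegral, Double.toEnd_mul, Double.counit_eq]
  have e₂ : ∀ b₁ b₂ : H, mulAct (Double.toEnd (Double.cointegral β l Lam lam) b₁) b₂
      (Double.toEnd d) = lam (antipode D b₁) • (((theta β l ^ (2 : ℤ) : Dˣ) : D) •
        mulAct (antipode D Lam) b₂ (Double.toEnd d)) := by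
    intro b₁ b₂
    rw [toEnd_cointegral, (show Lin D (fun z => mulAct z b₂ (Double.toEnd d)) by fun_prop).2,
      smul_smul, mul_comm]
  rw [sw_ext e₂, h.sw_antipode_left_apply b (fun b₂ => ((theta β l ^ (2 : ℤ) : Dˣ) : D) •
        mulAct (antipode D Lam) b₂ (Double.toEnd d)) (by fun_prop), mulAct_antipode_groupLike h,
    smul_smul, smul_smul, smul_smul]
  ring_nf

/-- Left multiplication by `H*` makes `b ↦ c(b)` a left integral, so `c(b) = λ(S(b))y`. Left
multiplication by `H` forces `xy = α⁻¹(x)y`, so `y` is a multiple of `S(Λ)`. -/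
theorem mem_span_of_isLeftCointegral {c : Double D H} (hc : IsLeftCointegral D c) :
    c ∈ Submodule.span D {Double.cointegral β l Lam lam} := by
  have hS := h.isUnit_antipode
  have e₁ : ∀ b, Double.toEnd c b = lam (antipode D b) • Double.toEnd c Lam := by
    refine h.eq_smul_of_left (fun b => Double.toEnd c b) (by fun_prop) fun q x => ?_
    rw [← Double.toEnd_inclDual_mul hS, hc, Double.counit_eq, Double.toEnd_inclDual, map_smul,
      LinearMap.smul_apply, map_smul, Bialgebra.counit_one, smul_eq_mul, mul_one]
  set y := Double.toEnd c Lam with hy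
  have e₂ : ∀ x : H, sw D x (fun p q => α q • (p * y)) = counit (R := D) x • y := by
    intro x
    -- At `b = S⁻¹(Λ)` the functional becomes `λ(S(x')Λx''')`, which the two cointegral rules for
    -- `Λ` reduce to `ε(x')α(x''')`.
    have e := Double.toEnd_incl_mul x c (antipodeInv D H Lam)
    rw [hc, Double.counit_eq, Double.toEnd_incl, map_smul, map_smul, LinearMap.smul_apply,
      Bialgebra.counit_one, one_smul, e₁, antipode_antipodeInv hS, h.apply_self, one_smul] at e
    rw [e, mulAct, ← sw_counit_left x (fun z => sw D z (fun p q => α q • (p * y))) (by fun_prop)]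
    refine sw_ext fun a z => ?_
    rw [smul_sw]
    refine sw_ext fun p q => ?_
    rw [e₁, antipode_mul_antidistrib, antipode_mul_antidistrib, antipode_antipodeInv hS,
      antipode_antipodeInv hS, h.mul, mul_smul_comm, mul_smul_comm, h.left, map_smul, map_smul,
      h.apply_self, counit_antipode, smul_smul, smul_eq_mul, smul_eq_mul, mul_one, mul_comm]
  have e₃ : ∀ x : H, x * y = α (antipode D x) • y := by
    intro x
    rw [← sw_algHom_smul_antipode_right α x (fun z => z * y) (by fun_prop),
      ← sw_coassoc x (fun r c d => (α c * α (antipode D d)) • (r * y))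
      (by fun_prop) (by fun_prop) (by fun_prop),
      ← sw_counit_left (D := D) x (fun z => α (antipode D z) • y) (by fun_prop)]
    refine sw_ext fun a b => ?_
    rw [smul_comm, ← e₂, smul_sw]
    refine sw_ext fun p q => ?_
    rw [smul_smul, mul_comm]
  refine mem_span_of_toEnd (lam y) fun b => ?_
  rw [e₁, h.eq_smul_of_mul_eq e₃, smul_smul, map_smul, h.apply_antipode, smul_eq_mul, mul_one,
    mul_comm]

/-- Right multiplication by `H` makes each `c(b)` a right cointegral of `H`, hence a multiple of
`S(Λ)`. Right multiplication by `H*` makes the coefficient, translated by `g⁻¹`, a right integral,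
and `λ(gb) = λ(S(b))` gives the form of `Λ_D`. -/
theorem mem_span_of_isRightCointegral {c : Double D H} (hc : IsRightCointegral D c) :
    c ∈ Submodule.span D {Double.cointegral β l Lam lam} := by
  have hS := h.isUnit_antipode
  have hX := h.isRightCointegral_antipode h.left
  set F := Double.toEnd c with hF
  have e₁ : ∀ b, F b = lam (F b) • antipode D Lam := by
    intro b
    refine h.eq_smul_of_isRightCointegral fun x => ?_
    rw [hF, ← Double.toEnd_mul_incl hS, hc, Double.counit_eq, Double.toEnd_incl, map_smul,
      map_smul, Bialgebra.counit_one, one_smul]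
    rfl
  have e₂ : ∀ (q : Dual D H) (b : H),
      sw D b (fun b₁ b₂ => lam (F b₁) * q (g * b₂)) = q 1 * lam (F b) := by
    intro q b
    -- Pairing with `λ( · g)` collapses the factors `X''`, `X'''` of `mulAct`, and takes the value
    -- `1` on `S(Λ)`.
    have e := congrArg (fun z => lam (z * g)) (LinearMap.congr_fun
      (congrArg Double.toEnd (hc (Double.inclDual D H q))) b)
    have e' : ∀ X : H, X = antipode D Lam → ∀ b₂ : H, lam (mulAct X b₂
        (Double.toEnd (Double.inclDual D H q)) * g) = q (g * b₂) := by
      intro X hX' b₂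
      rw [show Double.toEnd (Double.inclDual D H q) = q.smulRight (1 : H) from rfl,
        mulAct_smul_const, (show Lin D (fun z => lam (z * g)) by fun_prop).map_sw]
      have e'' : ∀ X₁ Z : H, lam (sw D Z (fun X₂ X₃ =>
          q (antipodeInv D H X₃ * b₂ * X₁) • (X₂ * 1)) * g) =
          lam (Z * g) • q (g * b₂ * X₁) := by
        intro X₁ Z
        rw [(show Lin D (fun z => lam (z * g)) by fun_prop).map_sw]
        have e₄ := h.sw_mul_groupLike_apply Z
          (fun X₃ => q (antipodeInv D H X₃ * b₂ * X₁)) (by fun_prop)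
        rw [antipodeInv_groupLike hS, inv_inv] at e₄
        rw [← e₄]
        refine sw_ext fun X₂ X₃ => ?_
        rw [mul_one, smul_mul_assoc, map_smul, smul_eq_mul, smul_eq_mul, mul_comm]
      rw [sw_ext e'', hX', h.sw_antipode_smul_right g (fun X₁ => q (g * b₂ * X₁)) (by fun_prop),
        antipodeInv_groupLike hS, groupLike_mul_inv, mul_one]
    rw [Double.toEnd_mul, map_smul, LinearMap.smul_apply, Double.counit_eq,
      Double.toEnd_inclDual, map_smul, Bialgebra.counit_one, smul_eq_mul, mul_one, ← hF, e₁ b] at e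
    simp only [smul_mul_assoc, map_smul, hX _, g.2.counit_eq_one, one_smul, h.apply_antipode,
      smul_eq_mul, mul_one] at e
    rw [← e, (show Lin D (fun z => lam (z * g)) by fun_prop).map_sw]
    refine sw_ext fun b₁ b₂ => ?_
    conv_rhs => rw [e₁ b₁, (show Lin D (fun z => lam (mulAct z b₂
      (Double.toEnd (Double.inclDual D H q)) * g)) by fun_prop).2, e' _ rfl]
    rfl
  have e₃ : ∀ x, lam (F (((g⁻¹ : GroupLike D H) : H) * x)) =
      lam (F (((g⁻¹ : GroupLike D H) : H) * antipode D Lam)) * lam x := by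
    refine h.eq_mul_of_right (fun x => lam (F (((g⁻¹ : GroupLike D H) : H) * x)))
      (by fun_prop) fun q x => ?_
    have e := e₂ q (((g⁻¹ : GroupLike D H) : H) * x)
    rw [sw_mul _ _ _ (by fun_prop) (by fun_prop),
      sw_groupLike (g⁻¹).2 _ (by fun_prop) (by fun_prop)] at e
    simpa only [← mul_assoc, groupLike_mul_inv, one_mul, smul_eq_mul, mul_comm (q 1)] using e
  refine mem_span_of_toEnd (lam (F (((g⁻¹ : GroupLike D H) : H) * antipode D Lam))) fun b => ?_
  have e := e₃ (g * b)
  rw [← mul_assoc, groupLike_inv_mul, one_mul, h.apply_groupLike_mul] at e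
  rw [← e, ← e₁]

end Cointegral

/-! ### Invariance of the cointegral under the antipode of the double. -/

section AntipodeCointegral

open HopfAlgebra

variable {D H : Type*} [CommRing D] [Ring H] [HopfAlgebra D H] [Module.Finite D H]
  {Lam : H} {lam : Dual D H} {α : H →ₐ[D] D} {g : GroupLike D H}
  {β : H →ₐ[D] D} {l : GroupLike D H} (h : IsIntegralPair Lam lam α g)

include h

theorem IsIntegralPair.algHom_antipodeInv (y : H) :
    α (antipodeInv D H y) = α (antipode D y) := by
  rw [← algHom_antipode_antipode, antipode_antipodeInv h.isUnit_antipode]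

/-- The Nakayama automorphism of `λ`, as `∑ α(y') λ(y''z) = λ(z S⁻²(y))`. -/
theorem IsIntegralPair.sw_modulus_apply_mul (y z : H) :
    sw D y (fun p q => α p * lam (q * z)) = lam (z * antipodeInv D H (antipodeInv D H y)) := by
  have hS := h.isUnit_antipode
  have e : ∀ q : H, lam (q * z) = sw D q (fun r s =>
      α (antipode D r) * lam (z * antipodeInv D H (antipodeInv D H s))) := by
    intro q
    have e' := h.apply_antipode_antipode_mul (antipodeInv D H (antipodeInv D H q)) z
    rw [antipode_antipodeInv hS, antipode_antipodeInv hS,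
      sw_antipodeInv hS _ _ (by fun_prop) (by fun_prop),
      sw_antipodeInv hS _ _ (by fun_prop) (by fun_prop)] at e'
    rw [e']
    refine sw_ext fun r s => ?_
    rw [antipode_antipodeInv hS, h.algHom_antipodeInv]
  rw [← sw_algHom_smul_antipode_left α y
    (fun s => lam (z * antipodeInv D H (antipodeInv D H s))) (by fun_prop)]
  refine sw_ext fun p q => ?_
  rw [e, ← smul_eq_mul, smul_sw]
  refine sw_ext fun r s => ?_
  rw [smul_eq_mul, smul_eq_mul, mul_assoc]

/-- The sum `∑ P(Λx'', x', x''')` is evaluated in two ways. Using `Λx'' = α(x'')Λ` and the Nakayama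
formula, the outer factors contract to `ε(x)`. Expanding `Δ(Λx'')`, the same factors cancel the
outer parts of `x''` and leave multiplication by `x`. -/
theorem isRightCointegral_mulAct (b : H) :
    IsRightCointegral D (mulAct Lam b (lam.smulRight (1 : H))) := by
  have hS := h.isUnit_antipode
  intro x
  have e₀ : mulAct Lam b (lam.smulRight (1 : H)) = sw D Lam (fun A W => sw D W (fun B C =>
      lam (antipodeInv D H C * b * A) • B)) := by
    simp only [mulAct_smul_const, mul_one]
  let P : H → H → H → H := fun c x₁ x₃ => sw D c (fun A W => sw D W (fun B C =>
    lam (x₃ * ((antipodeInv D H C * b * A) * antipodeInv D H x₁)) • B))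
  have side₁ : sw D x (fun x₁ y => sw D y (fun x₂ x₃ => P (Lam * x₂) x₁ x₃)) =
      counit (R := D) x • mulAct Lam b (lam.smulRight (1 : H)) := by
    let Q : H → H := fun u => sw D Lam (fun A W => sw D W (fun B C =>
      lam (antipodeInv D H C * b * A * u) • B))
    have hQ : Lin D Q := by fun_prop
    have e : ∀ x₁ y : H, sw D y (fun x₂ x₃ => P (Lam * x₂) x₁ x₃) =
        Q (antipodeInv D H (antipodeInv D H y * x₁)) := by
      intro x₁ y
      have e' : ∀ x₂ x₃ : H, P (Lam * x₂) x₁ x₃ = sw D Lam (fun A W => sw D W (fun B C =>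
          (α x₂ * lam (x₃ * ((antipodeInv D H C * b * A) * antipodeInv D H x₁))) • B)) := by
        intro x₂ x₃
        rw [h.mul, (show Lin D (fun c => P c x₁ x₃) by fun_prop).2, smul_sw]
        refine sw_ext fun A W => ?_
        rw [smul_sw]
        exact sw_ext fun B C => smul_smul _ _ _
      rw [sw_ext e', sw_comm]
      refine sw_ext fun A W => ?_
      rw [sw_comm]
      refine sw_ext fun B C => ?_
      rw [← sw_smul, h.sw_modulus_apply_mul, antipodeInv_mul hS]
      simp only [mul_assoc]
    rw [sw_ext e, ← (show Lin D (fun u => Q (antipodeInv D H u)) by fun_prop).map_sw,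
      sw_antipodeInv_mul_self hS, map_smul, hQ.2, antipodeInv_one hS, e₀]
    simp only [Q, mul_one]
  have side₂ : sw D x (fun x₁ y => sw D y (fun x₂ x₃ => P (Lam * x₂) x₁ x₃)) =
      mulAct Lam b (lam.smulRight (1 : H)) * x := by
    let R : H → H → H → H → H → H → H → H := fun A B C x₁ p r u =>
      lam (u * (antipodeInv D H C * b * A) * (p * antipodeInv D H x₁)) • (B * r)
    have e : ∀ x₁ x₂ x₃ : H, P (Lam * x₂) x₁ x₃ = sw D Lam (fun A W => sw D W (fun B C =>
        sw D x₂ (fun p q => sw D q (fun r s => R A B C x₁ p r (x₃ * antipodeInv D H s))))) := by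
      intro x₁ x₂ x₃
      simp only [P]
      rw [sw_mul _ _ _ (by fun_prop) (by fun_prop)]
      refine sw_ext fun A W => ?_
      rw [sw_comm]
      refine sw_ext fun p q => ?_
      rw [sw_mul _ _ _ (by fun_prop) (by fun_prop)]
      refine sw_ext fun B C => sw_ext fun r s => ?_
      simp only [R, antipodeInv_mul hS, mul_assoc]
    rw [sw_ext fun x₁ y => sw_ext fun x₂ x₃ => e x₁ x₂ x₃]
    rw [sw_ext fun x₁ y => sw_comm _ _ _, sw_comm, e₀,
      (show Lin D (fun z => z * x) by fun_prop).map_sw]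
    refine sw_ext fun A W => ?_
    rw [sw_ext fun x₁ y => sw_comm _ _ _, sw_comm,
      (show Lin D (fun z => z * x) by fun_prop).map_sw]
    refine sw_ext fun B C => ?_
    have e₁ : ∀ x₁ y : H, sw D y (fun x₂ x₃ => sw D x₂ (fun p q => sw D q (fun r s =>
        R A B C x₁ p r (x₃ * antipodeInv D H s)))) = sw D y (fun p v => R A B C x₁ p v 1) := by
      intro x₁ y
      rw [sw_coassoc y (fun p q x₃ => sw D q (fun r s =>
        R A B C x₁ p r (x₃ * antipodeInv D H s)))
        (by fun_prop) (by fun_prop) (by fun_prop)]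
      refine sw_ext fun p v => ?_
      rw [sw_coassoc v (fun r s x₃ => R A B C x₁ p r (x₃ * antipodeInv D H s))
        (by fun_prop) (by fun_prop) (by fun_prop)]
      exact sw_contract_right (sw_mul_antipodeInv_self hS) v (fun r u => R A B C x₁ p r u)
        (by fun_prop) (by fun_prop)
    rw [sw_ext e₁]
    simp only [R]
    rw [sw_contract_left (sw_mul_antipodeInv_self hS) (by fun_prop) (by fun_prop) x
      (fun w v => lam (1 * (antipodeInv D H C * b * A) * w) • (B * v))
      (by fun_prop) (by fun_prop), mul_one, one_mul, smul_mul_assoc]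
  exact side₂.symm.trans side₁

/-- Uniqueness of right cointegrals leaves one scalar, found by applying `λ`: the two integral
properties reduce it to `λ(bg) = α(g)λ(S(b))`. -/
theorem mulAct_smulRight_one (b : H) : mulAct Lam b (lam.smulRight (1 : H)) =
    (α g * lam (antipode D b)) • antipode D Lam := by
  have hS := h.isUnit_antipode
  rw [h.eq_smul_of_isRightCointegral (isRightCointegral_mulAct h b)]
  congr 1
  rw [mulAct_smul_const, map_sw, ← h.apply_mul_groupLike]
  have e : ∀ A W : H, lam (sw D W (fun B C => lam (antipodeInv D H C * b * A) • (B * 1))) =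
      lam W • lam (b * A) := by
    intro A W
    have e' := h.sw_left_apply W (fun C => lam (antipodeInv D H C * b * A)) (by fun_prop)
    rw [antipodeInv_one hS, one_mul] at e'
    rw [← e', map_sw]
    refine sw_ext fun B C => ?_
    rw [mul_one, map_smul, smul_eq_mul, smul_eq_mul, mul_comm]
  rw [sw_ext e, h.sw_right_apply Lam (fun A => lam (b * A)) (by fun_prop), h.apply_self, one_smul]

/-- `S²(Λ)` is again a left cointegral, so only its value under `λ` matters, and `λ(S²(Λ)) =
λ(gS(Λ)) = α⁻¹(g)`. -/
theorem IsIntegralPair.antipode_antipode_cointegral :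
    antipode D (antipode D Lam) = α (antipode D (g : H)) • Lam := by
  have e : IsLeftCointegral D (antipode D (antipode D Lam)) := by
    intro x
    rw [← antipode_antipodeInv h.isUnit_antipode x, ← antipode_mul_antidistrib,
      h.isRightCointegral_antipode h.left, map_smul, counit_antipode]
  have e' := h.eq_smul_of_isLeftCointegral e
  have e'' : lam (antipode D (antipode D Lam)) = α (antipode D (g : H)) := by
    rw [← h.apply_groupLike_mul, h.mul_antipode, map_smul, h.apply_antipode, smul_eq_mul, mul_one]
  rw [e', map_smul, h.apply_self, smul_eq_mul, mul_one] at e''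
  rw [e', e'']

/-- The image is `β(l)² (ε ⊗ S²(Λ))(λ ⊗ 1)`. The factor `α⁻¹(g)` from `S²(Λ)` cancels the factor
`α(g)` from the product. -/
theorem antipode_cointegral [Module.Projective D H] :
    Double.antipode D H (Double.cointegral β l Lam lam) = Double.cointegral β l Lam lam := by
  have hS := h.isUnit_antipode
  refine Double.ext_toEnd fun b => ?_
  have e : ((antipode D).dualMap lam) ∘ₗ antipodeInv D H = lam :=
    LinearMap.ext fun x => congrArg lam (antipode_antipodeInv hS x)
  rw [toEnd_cointegral, Double.cointegral, map_smul, map_smul, LinearMap.smul_apply,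
    Double.antipode_tmul, e, Double.toEnd_incl_mul,
    show Double.toEnd (Double.inclDual D H lam) = lam.smulRight (1 : H) from rfl,
    h.antipode_antipode_cointegral,
    (show Lin D (fun z => mulAct z b (lam.smulRight (1 : H))) by fun_prop).2,
    mulAct_smulRight_one h, smul_smul, smul_smul]
  congr 1
  linear_combination (((theta β l ^ (2 : ℤ) : Dˣ) : D) * lam (antipode D b)) *
    algHom_groupLike_mul_antipode α g

end AntipodeCointegral

/-! ### Right integrals on the double. -/

section RightIntegral

open HopfAlgebra

variable {D H : Type*} [CommRing D] [Ring H] [HopfAlgebra D H]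
  {Lam : H} {lam : Dual D H} {α : H →ₐ[D] D} {g : GroupLike D H}
  {β : H →ₐ[D] D} {l : GroupLike D H}

theorem integral_tmul (f : Dual D H) (x : H) :
    Double.integral β l Lam lam (Double.tmul f x) =
      ((theta β l ^ (-2 : ℤ) : Dˣ) : D) * (f Lam * lam x) := rfl

@[fun_prop] theorem Lin.double_tmul_left {N : Type*} [AddCommMonoid N] [Module D N]
    {f : N → Dual D H} (hf : Lin D f) (x : H) : Lin D (fun y => Double.tmul (f y) x) :=
  Lin.tmul_const hf x

@[fun_prop] theorem Lin.double_tmul_right {N : Type*} [AddCommMonoid N] [Module D N]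
    {f : N → H} (hf : Lin D f) (p : Dual D H) : Lin D (fun y => Double.tmul p (f y)) :=
  Lin.const_tmul hf p

variable [Module.Projective D H]

/-- The hypotheses on the integrals, in terms of elements. -/
theorem isIntegralPair_of_moduli (hLam : IsLeftCointegral D Lam) (hlam : IsRightIntegral lam)
    (hnorm : lam Lam = 1) (hnormS : lam (antipode D Lam) = 1)
    (hα : IsModulusOfCointegral Lam α) (hg : IsModulusOfIntegral lam g) :
    IsIntegralPair Lam lam α g where
  left := hLam
  mul := hα
  sw_left x := by
    rw [← sub_eq_zero, ← forall_dual_apply_eq_zero_iff D]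
    intro f
    have e := LinearMap.congr_fun (hlam f) x
    rw [dualMul_tmul_apply, LinearMap.smul_apply, smul_eq_mul] at e
    rw [map_sub, map_smul, map_sw, sub_eq_zero, smul_eq_mul, mul_comm, ← e]
    exact sw_ext fun a b => map_smul _ _ _
  sw_right x := by
    rw [← sub_eq_zero, ← forall_dual_apply_eq_zero_iff D]
    intro f
    have e := LinearMap.congr_fun (hg f) x
    rw [dualMul_tmul_apply, LinearMap.smul_apply, smul_eq_mul] at e
    rw [map_sub, map_smul, map_sw, sub_eq_zero, smul_eq_mul, mul_comm, ← e]
    exact sw_ext fun a b => (map_smul _ _ _).trans (mul_comm _ _)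
  apply_self := hnorm
  apply_antipode := hnormS

variable [Module.Finite D H]

theorem dualDistrib_dualComul (f : Dual D H) (x y : H) :
    dualDistrib D H H (dualComul D H f) (x ⊗ₜ[D] y) = f (x * y) := by
  let E := (homTensorHomEquiv D H H D D).trans (LinearEquiv.congrRight (TensorProduct.lid D D))
  have e : E.toLinearMap = dualDistrib D H H := by
    refine TensorProduct.ext' fun p q => TensorProduct.ext' fun x y => ?_
    simp [E, LinearEquiv.congrRight]
  rw [← e]
  exact LinearMap.congr_fun (E.apply_symm_apply ((LinearMap.mul' D H).dualMap f)) (x ⊗ₜ y)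

/-- The product of the dual of the double, in terms of a decomposition `∑ f' ⊗ f''` of the
coproduct of `f`. -/
theorem exists_dualComul (f : Dual D H) : ∃ s : Finset (Dual D H × Dual D H),
    (∀ x y : H, f (x * y) = ∑ i ∈ s, i.1 x * i.2 y) ∧
    ∀ (μ F : Dual D (Double D H)) (x : H), dualMul (μ ⊗ₜ[D] F) (Double.tmul f x) =
      ∑ i ∈ s, sw D x (fun a b => μ (Double.tmul i.2 a) * F (Double.tmul i.1 b)) := by
  obtain ⟨s, hs⟩ := TensorProduct.exists_finset (dualComul D H f)
  refine ⟨s, fun x y => ?_, fun μ F x => ?_⟩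
  · rw [← dualDistrib_dualComul, hs, map_sum, LinearMap.sum_apply]
    rfl
  · let μ' : Dual D (Dual D H ⊗[D] H) := μ
    let F' : Dual D (Dual D H ⊗[D] H) := F
    change dualDistrib D (Dual D H ⊗[D] H) (Dual D H ⊗[D] H) (μ' ⊗ₜ[D] F')
      (TensorProduct.tensorTensorTensorComm D (Dual D H) (Dual D H) H H
        (TensorProduct.comm D (Dual D H) (Dual D H) (dualComul D H f) ⊗ₜ[D] comul x)) = _
    rw [hs, map_sum, sum_tmul, map_sum, map_sum]
    refine Finset.sum_congr rfl fun i _ => ?_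
    rw [← sw_tmul x, tmul_sw, map_sw, map_sw]
    rfl

/-- The coproduct of the double is a flipped one on `H*` tensored with that of `H`. The `H` part
collapses by the right integral `λ`, the `H*` part because `yΛ = ε(y)Λ` gives `∑ f''(Λ)f' = f(Λ)ε`.
-/
theorem isRightIntegral_integral (h : IsIntegralPair Lam lam α g) :
    IsRightIntegral (Double.integral β l Lam lam) := by
  intro F
  ext a
  refine Double.eq_of_tmul (f := fun a => dualMul (Double.integral β l Lam lam ⊗ₜ[D] F) a)
    (g := fun a => (F 1 • Double.integral β l Lam lam) a) (by fun_prop) (by fun_prop)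
    (fun f x => ?_) a
  obtain ⟨s, hs, hs'⟩ := exists_dualComul f
  rw [hs', LinearMap.smul_apply, integral_tmul]
  set t := ((theta β l ^ (-2 : ℤ) : Dˣ) : D)
  have e : ∀ i : Dual D H × Dual D H, sw D x (fun a b =>
      Double.integral β l Lam lam (Double.tmul i.2 a) * F (Double.tmul i.1 b)) =
      (t * lam x) • (i.2 Lam • F (Double.tmul i.1 1)) := by
    intro i
    have e := h.sw_left_apply x (fun b => (t * i.2 Lam) * F (Double.tmul i.1 b)) (by fun_prop)
    refine Eq.trans (sw_ext fun a b => ?_) (e.trans ?_)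
    · rw [integral_tmul, smul_eq_mul]
      ring
    · simp only [smul_eq_mul]
      ring
  simp only [e]
  have e₂ : ∑ i ∈ s, i.2 Lam • i.1 = f Lam • (counit : Dual D H) := by
    ext y
    rw [LinearMap.sum_apply, LinearMap.smul_apply, smul_eq_mul, mul_comm, ← smul_eq_mul,
      ← map_smul, ← h.left, hs]
    exact Finset.sum_congr rfl fun i _ => mul_comm _ _
  have hL : Lin D (fun p : Dual D H => F (Double.tmul p 1)) := by fun_prop
  rw [← Finset.smul_sum]
  simp only [← hL.2]
  rw [← hL.map_sum, e₂, hL.2]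
  change (t * lam x) • f Lam • F 1 = _
  simp only [smul_eq_mul]
  ring

/-- Testing `μ` against `F(f ⊗ x) = f(b)q(x)` separates the variables. With `b = 1`, `x ↦ μ(f ⊗ x)`
is a right integral, hence a multiple of `λ`. With `q = ε`, the coefficient is evaluation of `f` at
a left cointegral, hence at a multiple of `Λ`. -/
theorem mem_span_of_isRightIntegral (h : IsIntegralPair Lam lam α g)
    {μ : Dual D (Double D H)} (hμ : IsRightIntegral μ) :
    μ ∈ Submodule.span D {Double.integral β l Lam lam} := by
  have key : ∀ (f q : Dual D H) (b x : H),
      sw D x (fun x₁ x₂ => μ (Double.tmul (coregRight D H b f) x₁) * q x₂) =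
        counit (R := D) b * q 1 * μ (Double.tmul f x) := by
    intro f q b x
    let F : Dual D (Double D H) := (dualDistrib D (Dual D H) H (Dual.eval D H b ⊗ₜ[D] q))
    have hF : ∀ p y, F (Double.tmul p y) = p b * q y := fun p y => rfl
    obtain ⟨s, hs, hs'⟩ := exists_dualComul f
    have e := LinearMap.congr_fun (hμ F) (Double.tmul f x)
    rw [hs', LinearMap.smul_apply, show F 1 = counit (R := D) b * q 1 from rfl, smul_eq_mul] at e
    rw [← e]
    have e₂ : coregRight D H b f = ∑ i ∈ s, i.1 b • i.2 := by
      ext y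
      rw [coregRight_apply, hs, LinearMap.sum_apply]
      rfl
    have e₃ : ∀ x₁ x₂ : H, μ (Double.tmul (coregRight D H b f) x₁) * q x₂ =
        ∑ i ∈ s, μ (Double.tmul i.2 x₁) * F (Double.tmul i.1 x₂) := by
      intro x₁ x₂
      have hL : Lin D (fun p : Dual D H => μ (Double.tmul p x₁) * q x₂) := by fun_prop
      rw [e₂, hL.map_sum]
      refine Finset.sum_congr rfl fun i _ => ?_
      rw [hL.2, hF, smul_eq_mul]
      ring
    rw [sw_ext e₃]
    exact Finset.sum_comm
  have e₁ : ∀ f x, μ (Double.tmul f x) = μ (Double.tmul f (antipode D Lam)) * lam x := by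
    intro f
    refine h.eq_mul_of_right (fun x => μ (Double.tmul f x)) (by fun_prop) fun q x => ?_
    have e := key f q 1 x
    rw [Bialgebra.counit_one, one_mul, mul_comm] at e
    rw [smul_eq_mul, ← e]
    refine sw_ext fun a b => ?_
    rw [show coregRight D H 1 f = f by ext; simp [coregRight_apply]]
    rfl
  let φ : Dual D (Dual D H) :=
    (show Lin D (fun f : Dual D H => μ (Double.tmul f (antipode D Lam)))
      by fun_prop).toLinearMap
  -- Reflexivity of the finite projective module `H` represents the coefficient by an element `c`.
  obtain ⟨c, hc⟩ : ∃ c : H, ∀ f : Dual D H, f c = μ (Double.tmul f (antipode D Lam)) :=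
    ⟨(evalEquiv D H).symm φ, fun f => by
      rw [← Dual.eval_apply (R := D), ← evalEquiv_toLinearMap, LinearEquiv.coe_coe,
        LinearEquiv.apply_symm_apply]
      rfl⟩
  have hcc : IsLeftCointegral D c := by
    intro b
    rw [← sub_eq_zero, ← forall_dual_apply_eq_zero_iff D]
    intro f
    have e := key f counit b (antipode D Lam)
    have e' := sw_counit_right (D := D) (antipode D Lam)
      (fun x => μ (Double.tmul (coregRight D H b f) x)) (by fun_prop)
    simp only [smul_eq_mul, mul_comm (counit (R := D) _)] at e'
    rw [e', ← hc, ← hc, Bialgebra.counit_one, mul_one, coregRight_apply] at e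
    rw [map_sub, map_smul, e, smul_eq_mul, sub_self]
  rw [Submodule.mem_span_singleton]
  -- Here `c = λ(S(c))Λ`, and `θ²` undoes the normalization of `λ_D`.
  refine ⟨lam (antipode D c) * ((theta β l ^ (2 : ℤ) : Dˣ) : D), ?_⟩
  ext a
  refine Double.eq_of_tmul (g := fun a => μ a) (f := fun a => ((lam (antipode D c) *
    ((theta β l ^ (2 : ℤ) : Dˣ) : D)) • Double.integral β l Lam lam) a) (by fun_prop) (by fun_prop)
    (fun f x => ?_) a
  have e : ((theta β l ^ (2 : ℤ) : Dˣ) : D) * ((theta β l ^ (-2 : ℤ) : Dˣ) : D) = 1 := by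
    rw [← Units.val_mul, ← Units.val_one]
    congr 1
    group
  rw [e₁, ← hc, h.eq_smul_of_isLeftCointegral hcc, LinearMap.smul_apply, integral_tmul, map_smul,
    map_smul, map_smul, h.apply_antipode]
  simp only [smul_eq_mul, mul_one]
  linear_combination (lam (antipode D c) * f Lam * lam x) * e

theorem IsRightIntegral.smul {A : Type*} [AddCommGroup A] [Module D A] [CoalgebraStruct D A]
    [One A] {μ : Dual D A} (hμ : IsRightIntegral μ) (c : D) : IsRightIntegral (c • μ) := by
  intro f
  rw [← smul_tmul', map_smul, hμ f, smul_comm]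

end RightIntegral

section SpanCointegral

variable {D H : Type*} [CommRing D] [Ring H] [HopfAlgebra D H]
  [Module.Finite D H] [Module.Projective D H]

theorem IsLeftCointegral.smul_double {c : Double D H} (hc : IsLeftCointegral D c) (t : D) :
    IsLeftCointegral D (t • c) := by
  intro x
  rw [mul_def, tmul_smul, map_smul, ← mul_def, hc, smul_comm]

theorem IsRightCointegral.smul_double {c : Double D H} (hc : IsRightCointegral D c) (t : D) :
    IsRightCointegral D (t • c) := by
  intro x
  rw [mul_def, ← smul_tmul', map_smul, ← mul_def, hc, smul_comm]

end SpanCointegral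

end HopfDouble

end

/-! ### Assembly of the proposition. -/

theorem mainTheorem9 {D : Type*} {H : Type*} [CommRing D] [IsDedekindDomain D]
    [Ring H] [HopfAlgebra D H] [Module.Finite D H] [Module.Projective D H]
    (Lam : H) (lam : Module.Dual D H)
    (hLam : HopfDouble.IsLeftCointegral D Lam) (hlam : HopfDouble.IsRightIntegral lam)
    (hnorm : lam Lam = 1) (hnormS : lam (HopfAlgebra.antipode D Lam) = 1)
    (α : H →ₐ[D] D) (g : GroupLike D H)
    (hα : HopfDouble.IsModulusOfCointegral Lam α) (hg : HopfDouble.IsModulusOfIntegral lam g)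
    (β : H →ₐ[D] D) (l : GroupLike D H) (hbal : HopfDouble.IsDoubleBalancing α g β l) :
    let lamD : Module.Dual D (HopfDouble.Double D H) := HopfDouble.Double.integral β l Lam lam
    let LamD : HopfDouble.Double D H := HopfDouble.Double.cointegral β l Lam lam
    let r : HopfDouble.Double D H := HopfDouble.Double.ribbon β l
    -- the form is a right integral and generates the right integrals
    HopfDouble.IsRightIntegral lamD ∧
    {μ : Module.Dual D (HopfDouble.Double D H) | HopfDouble.IsRightIntegral μ} =
      (Submodule.span D {lamD} : Set (Module.Dual D (HopfDouble.Double D H))) ∧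
    -- its values on the ribbon element and on the inverse of the ribbon element
    lamD r = ((HopfDouble.theta β l ^ (3 : ℤ) : Dˣ) : D) ∧
    (∃ s : HopfDouble.Double D H, r * s = 1 ∧ s * r = 1) ∧
    (∀ s : HopfDouble.Double D H, r * s = 1 → s * r = 1 →
      lamD s = ((HopfDouble.theta β l ^ (-3 : ℤ) : Dˣ) : D)) ∧
    -- the cointegral is two-sided and generates the left, and the right, cointegrals
    HopfDouble.IsLeftCointegral D LamD ∧ HopfDouble.IsRightCointegral D LamD ∧
    {c : HopfDouble.Double D H | HopfDouble.IsLeftCointegral D c} =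
      (Submodule.span D {LamD} : Set (HopfDouble.Double D H)) ∧
    {c : HopfDouble.Double D H | HopfDouble.IsRightCointegral D c} =
      (Submodule.span D {LamD} : Set (HopfDouble.Double D H)) ∧
    -- normalization and invariance under the antipode
    lamD LamD = 1 ∧ HopfDouble.Double.antipode D H LamD = LamD := by
  intro lamD LamD r
  have h := HopfDouble.isIntegralPair_of_moduli hLam hlam hnorm hnormS hα hg
  have hS := h.isUnit_antipode
  have hI : HopfDouble.IsRightIntegral lamD := HopfDouble.isRightIntegral_integral h
  have hL : HopfDouble.IsLeftCointegral D LamD := HopfDouble.isLeftCointegral_cointegral h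
  have hR : HopfDouble.IsRightCointegral D LamD := HopfDouble.isRightCointegral_cointegral h
  refine ⟨hI, ?_, HopfDouble.integral_ribbon h hbal,
    ⟨HopfDouble.ribbonInv β l, HopfDouble.ribbon_mul_ribbonInv hbal hS,
      HopfDouble.ribbonInv_mul_ribbon hbal hS⟩, fun s hs _ => ?_, hL, hR, ?_, ?_,
    HopfDouble.integral_cointegral h, HopfDouble.antipode_cointegral h⟩
  · refine Set.Subset.antisymm (fun μ hμ => HopfDouble.mem_span_of_isRightIntegral h hμ) ?_
    intro μ hμ
    obtain ⟨c, rfl⟩ := Submodule.mem_span_singleton.1 hμ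
    exact hI.smul c
  · rw [HopfDouble.eq_ribbonInv hbal hS hs]
    exact HopfDouble.integral_ribbonInv h
  · refine Set.Subset.antisymm (fun c hc => HopfDouble.mem_span_of_isLeftCointegral h hc) ?_
    intro c hc
    obtain ⟨t, rfl⟩ := Submodule.mem_span_singleton.1 hc
    exact hL.smul_double t
  · refine Set.Subset.antisymm (fun c hc => HopfDouble.mem_span_of_isRightCointegral h hc) ?_
    intro c hc
    obtain ⟨t, rfl⟩ := Submodule.mem_span_singleton.1 hc
    exact hR.smul_double t
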